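/- Let $H_n$ be the Hecke algebra over $\mathbb{C}(q)$ with generators $T_1,\dots,T_{n-1}$ and relations $(T_i-q)(T_i+q^{-1})=0$, $T_iT_{i+1}T_i=T_{i+1}T_iT_{i+1}$, and $T_iT_j=T_jT_i$ for $|i-j|>1$. For $a,b\in\mathbb{C}(q)$ with $a\neq 0$, $a\ne b$ put $F_i(a,b)=T_i+\dfrac{q-q^{-1}}{a^{-1}b-1}\in H_n$. For a standard tableau $\Lambda$ with $n$ boxes let $c_a(\Lambda)=j-i$ be the content of the box $(i,j)$ of $\Lambda$ containing the entry $a$, and let $$F_\Lambda(z_1,\dots,z_n)=\prod_{1\le i<j\le n}^{\rightarrow}F_{j-i}\bigl(q^{2c_i(\Lambda)}z_i,\;q^{2c_j(\Lambda)}z_j\bigr),$$ where the factor for $(i,j)$ stands to the left of the factor for $(i',j')$ if $j<j'$, or if $j=j'$ and $i<i'$. The $p$-th principal hook of a Young diagram $\lambda$ is the set of boxes $\{(p,j)\in\lambda: j\ge p\}\cup\{(i,p)\in\lambda: i\ge p\}$. Let $\mathcal{H}_\Lambda\subset\mathbb{C}(q)^n$ be the subspace of all $(z_1,\dots,z_n)$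 with $z_a=z_b$ whenever $a$ and $b$ lie in the same principal hook of $\Lambda$. When the restriction of the rational function $F_\Lambda(z_1,\dots,z_n)$ to $\mathcal{H}_\Lambda$ is regular at the points with $z_1=\dots=z_n\ne0$ and takes one and the same value at all of them, this value is denoted by $F_\Lambda\in H_n$. The hook tableau $\Lambda^\circ$ of shape $\lambda$ is the standard tableau obtained by writing $1,2,3,\dots$ into the principal hooks of $\lambda$ one after the other, each time first down the column of the hook (starting at its corner) and then along the rest of its row from left to right. **Proposition.** Let $\lambda=(\alpha_1,\dots,\alpha_d\,|\,\beta_1,\dots,\beta_d)$ be a partition of $n$, where $\alpha_i$ is the number of boxes of positive content in row $i$ and $\beta_i$ is the number of boxes of non-positive content in column $i$. Let $k\ge 0$ and let $\mu=(\alpha_{k+1},\dots,\alpha_d\,|\,\beta_{k+1},\dots,\beta_d)$ be the partition (of some $m\le n$) obtained by removing the first $k$ principal hooks of $\lambda$ (all of them, if $k\ge d$). Let $\Lambda^\circ$ and $\mathrm{M}^\circ$ be the hook tableaux of shapes $\lambda$ and $\mu$. Then the values $F_{\Lambda^\circ}\in H_n$ and $F_{\mathrm{M}^\circ}\in H_m$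 exist and are unique, and $$F_{\Lambda^\circ}=P\cdot F_{\mathrm{M}^\circ}$$ for some element $P\in H_n$, where $F_{\mathrm{M}^\circ}$ is regarded as an element of $H_n$ through the homomorphism $H_m\to H_n$ with $T_i\mapsto T_i$ for $1\le i<m$. -/

import Mathlib

noncomputable section

namespace HookFusion

/-- The ground field `ℂ(q)` of rational functions in one indeterminate `q`. -/
abbrev QField : Type := RatFunc ℂ

/-- The indeterminate `q`. -/
def q : QField := RatFunc.X

/-! ### The Hecke algebra -/

/-- The defining relations of the Hecke algebra. The generators `T_1, …, T_{n-1}` are indexed from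
zero: `T_{i+1}` is the free generator with index `i : Fin (n - 1)`. -/
inductive HeckeRel (n : ℕ) :
    FreeAlgebra QField (Fin (n - 1)) → FreeAlgebra QField (Fin (n - 1)) → Prop
  | quadratic (i : Fin (n - 1)) :
      HeckeRel n
        ((FreeAlgebra.ι QField i - algebraMap QField _ q) *
          (FreeAlgebra.ι QField i + algebraMap QField _ q⁻¹)) 0
  | braid (i j : Fin (n - 1)) (h : (j : ℕ) = (i : ℕ) + 1) :
      HeckeRel n
        (FreeAlgebra.ι QField i * FreeAlgebra.ι QField j * FreeAlgebra.ι QField i)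
        (FreeAlgebra.ι QField j * FreeAlgebra.ι QField i * FreeAlgebra.ι QField j)
  | comm (i j : Fin (n - 1)) (h : (i : ℕ) + 1 < (j : ℕ)) :
      HeckeRel n
        (FreeAlgebra.ι QField i * FreeAlgebra.ι QField j)
        (FreeAlgebra.ι QField j * FreeAlgebra.ι QField i)

/-- The Hecke algebra `H_n` over `ℂ(q)`, by generators and relations. -/
def Hecke (n : ℕ) : Type := RingQuot (HeckeRel n)

instance (n : ℕ) : Ring (Hecke n) := inferInstanceAs (Ring (RingQuot (HeckeRel n)))

instance (n : ℕ) : Algebra QField (Hecke n) :=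
  inferInstanceAs (Algebra QField (RingQuot (HeckeRel n)))

/-- The generator of `H_n` with zero-based index `i`, that is, `T_{i+1}`. -/
def T {n : ℕ} (i : Fin (n - 1)) : Hecke n :=
  RingQuot.mkAlgHom QField (HeckeRel n) (FreeAlgebra.ι QField i)

theorem T_quadratic {n : ℕ} (i : Fin (n - 1)) :
    (T i - algebraMap QField (Hecke n) q) * (T i + algebraMap QField (Hecke n) q⁻¹) = 0 := by
  have h := RingQuot.mkAlgHom_rel QField (HeckeRel.quadratic i)
  rw [map_mul, map_sub, map_add, AlgHom.commutes, AlgHom.commutes, map_zero] at h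
  exact h

theorem T_braid {n : ℕ} (i j : Fin (n - 1)) (h : (j : ℕ) = (i : ℕ) + 1) :
    (T i * T j * T i : Hecke n) = T j * T i * T j := by
  have h := RingQuot.mkAlgHom_rel QField (HeckeRel.braid i j h)
  rw [map_mul, map_mul, map_mul, map_mul] at h
  exact h

theorem T_comm {n : ℕ} (i j : Fin (n - 1)) (h : (i : ℕ) + 1 < (j : ℕ)) :
    (T i * T j : Hecke n) = T j * T i := by
  have h := RingQuot.mkAlgHom_rel QField (HeckeRel.comm i j h)
  rw [map_mul, map_mul] at h
  exact h

/-- The standard homomorphism `H_m → H_n` for `m ≤ n`, sending `T_i` to `T_i` for `1 ≤ i < m`. -/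
def incl {m n : ℕ} (h : m ≤ n) : Hecke m →ₐ[QField] Hecke n :=
  RingQuot.liftAlgHom QField
    ⟨FreeAlgebra.lift QField fun i : Fin (m - 1) =>
        (T (Fin.castLE (Nat.sub_le_sub_right h 1) i) : Hecke n), by
      intro x y hxy
      induction hxy with
      | quadratic i =>
        rw [map_mul, map_sub, map_add, AlgHom.commutes, AlgHom.commutes, map_zero,
          FreeAlgebra.lift_ι_apply]
        exact T_quadratic _
      | braid i j hij =>
        simp only [map_mul, FreeAlgebra.lift_ι_apply]
        exact T_braid _ _ hij
      | comm i j hij =>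
        simp only [map_mul, FreeAlgebra.lift_ι_apply]
        exact T_comm _ _ hij⟩

theorem incl_T {m n : ℕ} (h : m ≤ n) (i : Fin (m - 1)) :
    incl h (T i) = T (Fin.castLE (Nat.sub_le_sub_right h 1) i) := by
  refine (RingQuot.liftAlgHom_mkAlgHom_apply _ _ _ _).trans ?_
  exact FreeAlgebra.lift_ι_apply _ _

/-! ### Young diagrams, principal hooks, standard tableaux

Boxes are zero-based: the box `(i, j)` is in row `i` (counted downwards) and column `j`. -/

/-- The principal hook of `lam` with corner `(p, p)`. -/
def principalHook (lam : YoungDiagram) (p : ℕ) : Finset (ℕ × ℕ) :=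
  lam.cells.filter fun b => (b.1 = p ∧ p ≤ b.2) ∨ (b.2 = p ∧ p ≤ b.1)

theorem shift_injective (k : ℕ) :
    Function.Injective fun b : ℕ × ℕ => (b.1 + k, b.2 + k) := by
  intro a b h
  simp only [Prod.mk.injEq, add_left_inj] at h
  exact Prod.ext h.1 h.2

/-- The Young diagram left after the first `k` principal hooks are removed, moved by `(-k, -k)`
so that it starts at the corner again. -/
def removeHooks (lam : YoungDiagram) (k : ℕ) : YoungDiagram where
  cells := lam.cells.preimage (fun b => (b.1 + k, b.2 + k)) (shift_injective k).injOn
  isLowerSet := by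
    intro a b hba ha
    rw [Finset.mem_coe, Finset.mem_preimage] at ha ⊢
    exact lam.isLowerSet
      (Prod.mk_le_mk.2 ⟨Nat.add_le_add_right hba.1 k, Nat.add_le_add_right hba.2 k⟩) ha

theorem mem_removeHooks (lam : YoungDiagram) (k : ℕ) (b : ℕ × ℕ) :
    b ∈ removeHooks lam k ↔ (b.1 + k, b.2 + k) ∈ lam := by
  rw [← YoungDiagram.mem_cells, ← YoungDiagram.mem_cells]
  simp only [removeHooks, Finset.mem_preimage]

/-- Moved back by `(k, k)`, the boxes of `removeHooks lam k` are the boxes of `lam` outside its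
first `k` principal hooks. -/
theorem image_removeHooks (lam : YoungDiagram) (k : ℕ) :
    (removeHooks lam k).cells.image (fun b => (b.1 + k, b.2 + k)) =
      lam.cells \ (Finset.range k).biUnion (principalHook lam) := by
  ext ⟨i, j⟩
  simp only [Finset.mem_image, Finset.mem_sdiff, Finset.mem_biUnion, Finset.mem_range,
    principalHook, Finset.mem_filter, YoungDiagram.mem_cells, mem_removeHooks, Prod.mk.injEq,
    Prod.exists]
  constructor
  · rintro ⟨a, b, h, rfl, rfl⟩
    refine ⟨h, ?_⟩
    rintro ⟨p, hp, -, h | h⟩ <;> omega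
  · rintro ⟨h, hn⟩
    have hi : k ≤ i ∧ k ≤ j := by
      by_contra hc
      refine hn ⟨min i j, by omega, h, ?_⟩
      omega
    refine ⟨i - k, j - k, ?_, by omega, by omega⟩
    rwa [Nat.sub_add_cancel hi.1, Nat.sub_add_cancel hi.2]

theorem card_removeHooks_le (lam : YoungDiagram) (k : ℕ) :
    (removeHooks lam k).card ≤ lam.card := by
  refine Finset.card_le_card_of_injOn (fun b => (b.1 + k, b.2 + k)) ?_ ?_
  · intro b hb
    exact (mem_removeHooks lam k b).1 hb
  · exact (shift_injective k).injOn

/-- With zero-based `i`, the Frobenius coordinate `α_{i+1}`: the number of boxes of positive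
content in row `i`. -/
def frobeniusArm (lam : YoungDiagram) (i : ℕ) : ℕ := lam.rowLen i - (i + 1)

/-- With zero-based `i`, the Frobenius coordinate `β_{i+1}`: the number of boxes of non-positive
content in column `i`. -/
def frobeniusLeg (lam : YoungDiagram) (i : ℕ) : ℕ := lam.colLen i - i

theorem frobeniusArm_removeHooks (lam : YoungDiagram) (k i : ℕ) :
    frobeniusArm (removeHooks lam k) i = frobeniusArm lam (k + i) := by
  have h : ∀ j, j < (removeHooks lam k).rowLen i ↔ j + k < lam.rowLen (i + k) := fun j => by
    rw [← YoungDiagram.mem_iff_lt_rowLen, ← YoungDiagram.mem_iff_lt_rowLen, mem_removeHooks]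
  have h1 := h ((removeHooks lam k).rowLen i)
  have h2 := h ((removeHooks lam k).rowLen i - 1)
  unfold frobeniusArm
  rw [add_comm k i]
  omega

theorem frobeniusLeg_removeHooks (lam : YoungDiagram) (k i : ℕ) :
    frobeniusLeg (removeHooks lam k) i = frobeniusLeg lam (k + i) := by
  have h : ∀ j, j < (removeHooks lam k).colLen i ↔ j + k < lam.colLen (i + k) := fun j => by
    rw [← YoungDiagram.mem_iff_lt_colLen, ← YoungDiagram.mem_iff_lt_colLen, mem_removeHooks]
  have h1 := h ((removeHooks lam k).colLen i)
  have h2 := h ((removeHooks lam k).colLen i - 1)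
  unfold frobeniusLeg
  rw [add_comm k i]
  omega

/-- A standard tableau of shape `lam`. The entries `1, …, n` are represented by `Fin n`, so that
`box a` is the box containing the entry `a + 1`. Entries increase along rows and down columns. -/
structure StandardTableau (lam : YoungDiagram) where
  box : Fin lam.card ≃ {b : ℕ × ℕ // b ∈ lam.cells}
  row_increasing : ∀ a b : Fin lam.card,
    (box a).1.1 = (box b).1.1 → (box a).1.2 < (box b).1.2 → a < b
  col_increasing : ∀ a b : Fin lam.card,
    (box a).1.2 = (box b).1.2 → (box a).1.1 < (box b).1.1 → a < b

/-- The content `j - i` of the box `(i, j)` containing the given entry. -/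
def StandardTableau.content {lam : YoungDiagram} (L : StandardTableau lam)
    (a : Fin lam.card) : ℤ :=
  ((L.box a).1.2 : ℤ) - ((L.box a).1.1 : ℤ)

/-- The order in which the hook tableau is filled, as a lexicographic key: earlier principal hooks
come first; inside a principal hook the column (with the corner) comes first, downwards, and then
the rest of the row, from left to right. -/
def hookKey (b : ℕ × ℕ) : ℕ ×ₗ (ℕ ×ₗ ℕ) :=
  toLex (min b.1 b.2, toLex (if b.1 < b.2 then 1 else 0, max b.1 b.2))

theorem hookKey_lt_iff (b c : ℕ × ℕ) :
    hookKey b < hookKey c ↔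
      min b.1 b.2 < min c.1 c.2 ∨ min b.1 b.2 = min c.1 c.2 ∧
        ((if b.1 < b.2 then 1 else 0) < (if c.1 < c.2 then 1 else 0) ∨
          (if b.1 < b.2 then 1 else 0) = (if c.1 < c.2 then 1 else 0) ∧
            max b.1 b.2 < max c.1 c.2) := by
  simp [hookKey, Prod.Lex.toLex_lt_toLex]

theorem hookKey_injective : Function.Injective hookKey := by
  intro b c h
  simp only [hookKey, EmbeddingLike.apply_eq_iff_eq, Prod.mk.injEq] at h
  obtain ⟨h1, h2, h3⟩ := h
  apply Prod.ext <;> split_ifs at h2 <;> omega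

/-- The zero-based entry of the box `b` in the hook tableau: the number of boxes filled
before `b`. -/
def hookEntry (lam : YoungDiagram) (b : ℕ × ℕ) : ℕ :=
  (lam.cells.filter fun c => hookKey c < hookKey b).card

theorem hookEntry_lt (lam : YoungDiagram) (b : ℕ × ℕ) (hb : b ∈ lam.cells) :
    hookEntry lam b < lam.card :=
  Finset.card_lt_card (Finset.filter_ssubset.2 ⟨b, hb, lt_irrefl _⟩)

theorem hookEntry_strict (lam : YoungDiagram) {b c : ℕ × ℕ} (hb : b ∈ lam.cells)
    (h : hookKey b < hookKey c) : hookEntry lam b < hookEntry lam c := by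
  refine Finset.card_lt_card (Finset.ssubset_iff_of_subset ?_ |>.2 ⟨b, ?_, ?_⟩)
  · intro x hx
    rw [Finset.mem_filter] at hx ⊢
    exact ⟨hx.1, hx.2.trans h⟩
  · exact Finset.mem_filter.2 ⟨hb, h⟩
  · exact fun hx => lt_irrefl _ (Finset.mem_filter.1 hx).2

/-- The filling of the boxes by the hook tableau. -/
def hookFilling (lam : YoungDiagram) (b : {b : ℕ × ℕ // b ∈ lam.cells}) : Fin lam.card :=
  ⟨hookEntry lam b.1, hookEntry_lt lam b.1 b.2⟩

theorem hookFilling_lt (lam : YoungDiagram) (b c : {b : ℕ × ℕ // b ∈ lam.cells})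
    (h : hookKey b.1 < hookKey c.1) : hookFilling lam b < hookFilling lam c :=
  hookEntry_strict lam b.2 h

theorem hookFilling_bijective (lam : YoungDiagram) : Function.Bijective (hookFilling lam) := by
  rw [Fintype.bijective_iff_injective_and_card]
  constructor
  · intro b c h
    rcases lt_trichotomy (hookKey b.1) (hookKey c.1) with hlt | heq | hgt
    · exact absurd h (hookFilling_lt lam b c hlt).ne
    · exact Subtype.ext (hookKey_injective heq)
    · exact absurd h (hookFilling_lt lam c b hgt).ne'
  · rw [Fintype.card_coe, Fintype.card_fin]

/-- The hook tableau of shape `lam`. -/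
def hookTableau (lam : YoungDiagram) : StandardTableau lam where
  box := (Equiv.ofBijective (hookFilling lam) (hookFilling_bijective lam)).symm
  row_increasing := by
    intro a b h1 h2
    have h := hookFilling_lt lam
      ((Equiv.ofBijective (hookFilling lam) (hookFilling_bijective lam)).symm a)
      ((Equiv.ofBijective (hookFilling lam) (hookFilling_bijective lam)).symm b) (by
        rw [hookKey_lt_iff]
        split_ifs <;> omega)
    rwa [Equiv.ofBijective_apply_symm_apply (hookFilling lam) (hookFilling_bijective lam),
      Equiv.ofBijective_apply_symm_apply (hookFilling lam) (hookFilling_bijective lam)] at h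
  col_increasing := by
    intro a b h1 h2
    have h := hookFilling_lt lam
      ((Equiv.ofBijective (hookFilling lam) (hookFilling_bijective lam)).symm a)
      ((Equiv.ofBijective (hookFilling lam) (hookFilling_bijective lam)).symm b) (by
        rw [hookKey_lt_iff]
        split_ifs <;> omega)
    rwa [Equiv.ofBijective_apply_symm_apply (hookFilling lam) (hookFilling_bijective lam),
      Equiv.ofBijective_apply_symm_apply (hookFilling lam) (hookFilling_bijective lam)] at h

/-! ### The rational function `F_Λ(z_1, …, z_n)` and its value -/

/-- `F_{r+1}(a, b) = T_{r+1} + (q - q⁻¹) / (a⁻¹ b - 1)`, meant for `a ≠ 0` and `a ≠ b`. -/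
def factor {n : ℕ} (r : Fin (n - 1)) (a b : QField) : Hecke n :=
  T r + algebraMap QField (Hecke n) ((q - q⁻¹) / (a⁻¹ * b - 1))

/-- `q ^ {2 c_a(Λ)} z_a`. -/
def weight {lam : YoungDiagram} (L : StandardTableau lam) (z : Fin lam.card → QField)
    (a : Fin lam.card) : QField :=
  q ^ (2 * L.content a) * z a

/-- The set of `z` at which every factor of `F_Λ(z_1, …, z_n)` is defined. -/
def domain {lam : YoungDiagram} (L : StandardTableau lam) : Set (Fin lam.card → QField) :=
  {z | ∀ i j : Fin lam.card, i < j → weight L z i ≠ 0 ∧ weight L z i ≠ weight L z j}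

/-- `F_Λ(z_1, …, z_n)`: the ordered product of `F_{j-i}(q^{2c_i} z_i, q^{2c_j} z_j)` over the pairs
`i < j`, where `(i, j)` precedes `(i', j')` if `j < j'`, or if `j = j'` and `i < i'`. It is meant
on `domain Λ`. -/
def fusionProduct {lam : YoungDiagram} (L : StandardTableau lam) (z : Fin lam.card → QField) :
    Hecke lam.card :=
  ((List.finRange lam.card).map fun j : Fin lam.card =>
    ((List.finRange (j : ℕ)).map fun i : Fin (j : ℕ) =>
      factor (n := lam.card) ⟨(j : ℕ) - (i : ℕ) - 1, by omega⟩
        (weight L z ⟨(i : ℕ), i.2.trans j.2⟩) (weight L z j)).prod).prod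

/-- The subspace of tuples with `z_a = z_b` whenever `a` and `b` are in the same principal hook. -/
def hookSubspace {lam : YoungDiagram} (L : StandardTableau lam) :
    Submodule QField (Fin lam.card → QField) where
  carrier := {z | ∀ (p : ℕ) (a b : Fin lam.card),
    (L.box a).1 ∈ principalHook lam p → (L.box b).1 ∈ principalHook lam p → z a = z b}
  add_mem' := by
    intro x y hx hy p a b ha hb
    simp only [Pi.add_apply]
    rw [hx p a b ha hb, hy p a b ha hb]
  zero_mem' := fun _ _ _ _ _ => rfl
  smul_mem' := by
    intro c x hx p a b ha hb
    simp only [Pi.smul_apply]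
    rw [hx p a b ha hb]

/-- The restriction to `S` of the `A`-valued rational function `f`, with domain of definition `D`,
is regular at the point `p` and takes the value `v` there: on `S` it can be written as
`(∑ l, num l • h l) / den` with `h l ∈ A` and polynomials `num l` and `den`, where `den` does not
vanish at `p`; and `v` is the value of this expression at `p`. -/
def HasRegularValueAt {n : ℕ} {A : Type} [Ring A] [Algebra QField A]
    (f : (Fin n → QField) → A) (D S : Set (Fin n → QField)) (p : Fin n → QField) (v : A) : Prop :=
  ∃ (r : ℕ) (h : Fin r → A) (num : Fin r → MvPolynomial (Fin n) QField)
    (den : MvPolynomial (Fin n) QField),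
    MvPolynomial.eval p den ≠ 0 ∧
    (∀ z ∈ S, z ∈ D →
      MvPolynomial.eval z den • f z = ∑ l, MvPolynomial.eval z (num l) • h l) ∧
    v = (MvPolynomial.eval p den)⁻¹ • ∑ l, MvPolynomial.eval p (num l) • h l

/-- The restriction of `F_Λ(z_1, …, z_n)` to the subspace of the principal hooks is regular at all
points with `z_1 = ⋯ = z_n ≠ 0`, and takes the value `v` at each of them. -/
def IsFusionValue {lam : YoungDiagram} (L : StandardTableau lam) (v : Hecke lam.card) : Prop :=
  ∀ t : QField, t ≠ 0 →
    HasRegularValueAt (fusionProduct L) (domain L) (hookSubspace L) (fun _ => t) v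

open Classical in
/-- The element `F_Λ` of `H_n`: the value of the restriction of `F_Λ(z_1, …, z_n)` to the subspace
of the principal hooks at `z_1 = ⋯ = z_n ≠ 0` (zero if there is no such value). -/
def fusionElement {lam : YoungDiagram} (L : StandardTableau lam) : Hecke lam.card :=
  if h : ∃ v, IsFusionValue L v then h.choose else 0

end HookFusion

end

noncomputable section

namespace HookFusion

/-! On the diagonal $z_1=\dots=z_n\neq0$ the factor of a pair $i<j$ is singular exactly when the two
contents agree, because $q$ is not a root of unity.

Existence of the value. In a hook tableau, if $a<b$ have equal contents, then $a+1<b$, and $a+1$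
lies next to $a$ in the same hook (`hookTableau_next`). On the hook subspace the parameters of $a$
and $a+1$ therefore have ratio $q^{\pm2}$, and their own factor is $T+e$ with $e=q^{-1}$ or $e=-q$,
an eigenvector of $T$. The Yang–Baxter equation carries this factor to the right end of the product
of the earlier columns (`triProd_right_divisible`). In front of the factors for $(a,b)$ and
$(a+1,b)$ there thus stands an eigenvector of the generator in the second of them, and this cancels
the pole of the first (`mul_natFactor_mul_natFactor`). Induction on columns, and on the factors
within a column, gives regularity (`exists_isFusionValue`).

Uniqueness. The hook subspace is irreducible and the product is defined on a nonempty open part of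
it, so two fractions that represent it agree wherever both are regular
(`fusionProduct_value_unique`).

Divisibility. Moving to the left all pairs whose first entry lies in the removed hooks gives
$F_{\Lambda^\circ}(z)=R(z)\,F_{\mathrm{M}^\circ}(z')$, where $z'$ is the tail of $z$
(`fusionProduct_eq_rows_mul`). At the diagonal $R$ may be singular. At a generic point whose
coordinates outside the first $k$ hooks are all equal, however, $R$ is regular and the second factor
has the value $F_{\mathrm{M}^\circ}$, so the product has its value in the left ideal
$H_nF_{\mathrm{M}^\circ}$. A linear subspace is closed, so the value at the diagonal, a
specialization of such points, lies in it too (`exists_eq_mul_of_isFusionValue`). -/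

theorem q_ne_zero : q ≠ 0 := RatFunc.X_ne_zero

theorem q_pow_ne_one {k : ℕ} (hk : k ≠ 0) : q ^ k ≠ 1 := by
  intro h
  rw [q, ← RatFunc.algebraMap_X, ← map_pow, ← map_one (algebraMap (Polynomial ℂ) (RatFunc ℂ))] at h
  have h1 := RatFunc.algebraMap_injective ℂ h
  have h2 := congrArg Polynomial.natDegree h1
  rw [Polynomial.natDegree_X_pow, Polynomial.natDegree_one] at h2
  exact hk h2

/-- This separates the weights of entries of different content at diagonal points, so that only
equal contents can cause poles there. -/
theorem q_zpow_injective : Function.Injective fun k : ℤ => q ^ k := by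
  have key : ∀ k : ℤ, q ^ k = 1 → k = 0 := by
    intro k hk
    by_contra hne
    refine q_pow_ne_one (k := k.natAbs) (by omega) ?_
    rcases Int.natAbs_eq k with h | h
    · rw [h, zpow_natCast] at hk
      exact hk
    · rw [h, zpow_neg, zpow_natCast, inv_eq_one] at hk
      exact hk
  intro a b hab
  have : q ^ (a - b) = 1 := by
    rw [zpow_sub₀ q_ne_zero]
    exact (div_eq_one_iff_eq (zpow_ne_zero _ q_ne_zero)).2 hab
  have := key _ this
  omega

theorem q_zpow_two_mul_ne {a b : ℤ} (h : a ≠ b) : q ^ (2 * a) ≠ q ^ (2 * b) := fun h' => h (by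
  have := q_zpow_injective h'
  omega)

/-! ### Ordered products in the Hecke algebra, indexed by natural numbers -/

/-- The generator with zero-based index `r`, and zero when there is none. -/
def natT (n r : ℕ) : Hecke n := if h : r < n - 1 then T ⟨r, h⟩ else 0

/-- `F_{r+1}(a, b)`, indexed by natural numbers. -/
def natFactor (n r : ℕ) (a b : QField) : Hecke n :=
  natT n r + algebraMap QField (Hecke n) ((q - q⁻¹) / (a⁻¹ * b - 1))

theorem natT_commute (n : ℕ) {r s : ℕ} (h : r + 1 < s) : Commute (natT n r) (natT n s) := by
  unfold natT
  split_ifs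
  · exact T_comm _ _ h
  · exact Commute.zero_right _
  · exact Commute.zero_left _
  · exact Commute.zero_left _

theorem natFactor_commute_natT (n : ℕ) {r s : ℕ} (h : r + 1 < s) (a b : QField) :
    Commute (natFactor n s a b) (natT n r) :=
  (natT_commute n h).symm.add_left (Algebra.commutes _ _)

theorem natFactor_commute (n : ℕ) {r s : ℕ} (h : r + 1 < s) (a b c d : QField) :
    Commute (natFactor n r a b) (natFactor n s c d) :=
  ((natFactor_commute_natT n h c d).symm).add_left (Algebra.commutes _ _)

/-! ### Quadratic relation, braid relation and the Yang–Baxter equation. -/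

theorem sq_of_quadratic {K A : Type*} [Field K] [Ring A] [Algebra K A] {k : K} (hk : k ≠ 0) {x : A}
    (h : (x - algebraMap K A k) * (x + algebraMap K A k⁻¹) = 0) :
    x * x = (k - k⁻¹) • x + 1 := by
  simp only [Algebra.algebraMap_eq_smul_one, mul_add, sub_mul, mul_smul_comm, smul_mul_assoc,
    mul_one, one_mul, smul_sub, smul_smul, inv_mul_cancel₀ hk, one_smul] at h
  rw [← sub_eq_zero, ← h, sub_smul]
  abel

theorem natT_sq {n r : ℕ} (h : r < n - 1) :
    natT n r * natT n r = (q - q⁻¹) • natT n r + 1 := by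
  simp only [natT, dif_pos h]
  exact sq_of_quadratic q_ne_zero (T_quadratic _)

theorem natT_braid {n r : ℕ} (h : r + 1 < n - 1) :
    natT n r * natT n (r + 1) * natT n r = natT n (r + 1) * natT n r * natT n (r + 1) := by
  simp only [natT, dif_pos h, dif_pos (Nat.lt_of_succ_lt h)]
  exact T_braid _ _ rfl

/-- For nonzero `k`, `x`, `y`, `z` the scalar condition reads $(1+k/x)(1+k/z)=1+k/y$. In the
application these three numbers are the ratios $b/a$, $c/b$, $c/a$. After expansion the two sides
differ by a multiple of `s - t`, and the condition makes the coefficient vanish. -/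
theorem yangBaxter_of_quadratic {K A : Type*} [Field K] [Ring A] [Algebra K A] {k : K} {s t : A}
    (hs : s * s = k • s + 1) (ht : t * t = k • t + 1) (hb : s * t * s = t * s * t) {x y z : K}
    (hxyz : k * y + x * y + y * z = x * z) :
    (s + algebraMap K A x) * (t + algebraMap K A y) * (s + algebraMap K A z) =
      (t + algebraMap K A z) * (s + algebraMap K A y) * (t + algebraMap K A x) := by
  have e : (k * y + x * y + y * z) • (s - t) = (x * z) • (s - t) := by rw [hxyz]
  simp only [Algebra.algebraMap_eq_smul_one, mul_add, add_mul, mul_smul_comm, smul_mul_assoc,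
    mul_one, one_mul, smul_smul, hs, ht, hb, smul_add]
  simp only [add_smul, smul_sub] at e
  rw [← sub_eq_zero] at e ⊢
  rw [← e]
  module

/-- The form $a/(b-a)$ is a quotient of polynomials in the parameters and depends only on their
ratio. -/
theorem div_inv_mul_sub_one {a : QField} (ha : a ≠ 0) (h b : QField) :
    h / (a⁻¹ * b - 1) = h * (a / (b - a)) := by
  have : a⁻¹ * b - 1 = (b - a) / a := by field_simp
  rw [this, div_div_eq_mul_div, mul_div_assoc]

theorem natFactor_yangBaxter {n r : ℕ} (h : r + 1 < n - 1) {a b c : QField} (ha : a ≠ 0)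
    (hb : b ≠ 0) (hab : a ≠ b) (hac : a ≠ c) (hbc : b ≠ c) :
    natFactor n r a b * natFactor n (r + 1) a c * natFactor n r b c =
      natFactor n (r + 1) b c * natFactor n r a c * natFactor n (r + 1) a b := by
  apply yangBaxter_of_quadratic (natT_sq (Nat.lt_of_succ_lt h)) (natT_sq h) (natT_braid h)
  rw [div_inv_mul_sub_one ha, div_inv_mul_sub_one ha, div_inv_mul_sub_one hb]
  have h1 := sub_ne_zero.2 hab.symm
  have h2 := sub_ne_zero.2 hac.symm
  have h3 := sub_ne_zero.2 hbc.symm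
  generalize q - q⁻¹ = k
  field_simp
  ring

/-! ### Columns of the ordered product and its right divisors. -/

/-- The product of `F_{j-i}(w_i, w_j)` over `i < p`. -/
def colProd (n : ℕ) (w : ℕ → QField) (j p : ℕ) : Hecke n :=
  ((List.range p).map fun i => natFactor n (j - i - 1) (w i) (w j)).prod

/-- The product of `F_{j-i}(w_i, w_j)` over `i < j < N`, ordered by `j` and then by `i`. -/
def triProd (n : ℕ) (w : ℕ → QField) (N : ℕ) : Hecke n :=
  ((List.range N).map fun j => colProd n w j j).prod

theorem colProd_succ (n : ℕ) (w : ℕ → QField) (j p : ℕ) :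
    colProd n w j (p + 1) = colProd n w j p * natFactor n (j - p - 1) (w p) (w j) := by
  simp [colProd, List.range_succ]

theorem triProd_succ (n : ℕ) (w : ℕ → QField) (N : ℕ) :
    triProd n w (N + 1) = triProd n w N * colProd n w N N := by
  simp [triProd, List.range_succ]

theorem colProd_commute (n : ℕ) (w : ℕ → QField) {j p : ℕ} {x : Hecke n}
    (h : ∀ i < p, Commute (natFactor n (j - i - 1) (w i) (w j)) x) :
    Commute (colProd n w j p) x := by
  induction p with
  | zero => exact Commute.one_left x
  | succ p ih =>
    rw [colProd_succ]
    exact (ih fun i hi => h i (by omega)).mul_left (h p (by omega))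

/-- The ordered product is divisible on the right by the factor of any two consecutive
parameters. -/
theorem triProd_right_divisible {n : ℕ} {w : ℕ → QField} {N : ℕ} (hN : N ≤ n)
    (h0 : ∀ i j, i < j → j < N → w i ≠ 0) (hw : ∀ i j, i < j → j < N → w i ≠ w j)
    {p : ℕ} (hp : p + 1 < N) :
    ∃ X, triProd n w N = X * natFactor n (N - p - 2) (w p) (w (p + 1)) := by
  induction N with
  | zero => omega
  | succ N ih =>
    rw [triProd_succ]
    rcases Nat.lt_or_ge (p + 1) N with hlt | hge
    · obtain ⟨X, hX⟩ := ih (by omega) (fun i j hi hj => h0 i j hi (by omega))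
        (fun i j hi hj => hw i j hi (by omega)) hlt
      -- Column `N` is multiplied on factor by factor. Its factors before `p` commute with the
      -- divisor, those of `p` and `p + 1` raise the index of the divisor by one through
      -- Yang–Baxter, and the later ones commute with the raised divisor.
      have key : ∀ P, p + 2 ≤ P → P ≤ N →
          ∃ Y, triProd n w N * colProd n w N P =
            Y * natFactor n (N - p - 1) (w p) (w (p + 1)) := by
        intro P hP
        induction P, hP using Nat.le_induction with
        | base =>
          intro _
          have e : N - p - 1 = N - p - 2 + 1 := by omega
          have e' : N - (p + 1) - 1 = N - p - 2 := by omega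
          have hyb := natFactor_yangBaxter (n := n) (r := N - p - 2) (a := w p) (b := w (p + 1))
            (c := w N) (by omega) (h0 p N (by omega) (by omega))
            (h0 (p + 1) N (by omega) (by omega)) (hw _ _ (by omega) (by omega))
            (hw _ _ (by omega) (by omega)) (hw _ _ (by omega) (by omega))
          have hc : Commute (colProd n w N p) (natFactor n (N - p - 2) (w p) (w (p + 1))) :=
            colProd_commute n w fun i hi => (natFactor_commute n (by omega) _ _ _ _).symm
          refine ⟨X * colProd n w N p * (natFactor n (N - p - 1) (w (p + 1)) (w N) *
            natFactor n (N - p - 2) (w p) (w N)), ?_⟩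
          rw [colProd_succ, colProd_succ, e', hX, e]
          calc _ = X * (natFactor n (N - p - 2) (w p) (w (p + 1)) * colProd n w N p) *
                (natFactor n (N - p - 2 + 1) (w p) (w N) *
                  natFactor n (N - p - 2) (w (p + 1)) (w N)) := by simp only [mul_assoc]
            _ = X * colProd n w N p * (natFactor n (N - p - 2) (w p) (w (p + 1)) *
                natFactor n (N - p - 2 + 1) (w p) (w N) *
                  natFactor n (N - p - 2) (w (p + 1)) (w N)) := by
                rw [← hc.eq]; simp only [mul_assoc]
            _ = _ := by rw [hyb]; simp only [mul_assoc]
        | succ P hP ih' =>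
          intro hPN
          obtain ⟨Y, hY⟩ := ih' (by omega)
          refine ⟨Y * natFactor n (N - P - 1) (w P) (w N), ?_⟩
          have hc := natFactor_commute n (show N - P - 1 + 1 < N - p - 1 by omega) (w P) (w N)
            (w p) (w (p + 1))
          rw [colProd_succ, ← mul_assoc, hY, mul_assoc, mul_assoc, hc.eq]
      have e : N + 1 - p - 2 = N - p - 1 := by omega
      rw [e]
      exact key N (by omega) le_rfl
    · have hpN : N = p + 1 := by omega
      subst hpN
      refine ⟨triProd n w (p + 1) * colProd n w (p + 1) p, ?_⟩
      have e : p + 1 + 1 - p - 2 = p + 1 - p - 1 := by omega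
      rw [colProd_succ, e, mul_assoc]

/-! ### Eigenvectors and the cancellation of poles. -/

theorem natFactor_mul_natT {n r : ℕ} (h : r < n - 1) {e a b : QField} (he : e = q⁻¹ ∨ e = -q)
    (ha : a ≠ 0) (hab : a = e ^ 2 * b) :
    natFactor n r a b * natT n r = e⁻¹ • natFactor n r a b := by
  have he0 : e ≠ 0 := by
    rcases he with rfl | rfl
    · exact inv_ne_zero q_ne_zero
    · exact neg_ne_zero.2 q_ne_zero
  have hh : q - q⁻¹ = e⁻¹ - e := by
    rcases he with rfl | rfl
    · rw [inv_inv]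
    · rw [neg_eq_neg_one_mul, mul_inv, inv_neg, inv_one]; ring
  have hb : b ≠ 0 := by rintro rfl; exact ha (by rw [hab, mul_zero])
  have he2 : 1 - e ^ 2 ≠ 0 := by
    have h2 := q_pow_ne_one (k := 2) two_ne_zero
    rcases he with rfl | rfl
    · rw [inv_pow, sub_ne_zero, ne_comm, Ne, inv_eq_one]
      exact h2
    · rw [neg_sq, sub_ne_zero]
      exact h2.symm
  -- With this ratio of parameters the factor is $T+e$; for both choices of $e$ the quadratic
  -- relation reads $(T+e)(T-e^{-1})=0$.
  have hx : (q - q⁻¹) / (a⁻¹ * b - 1) = e := by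
    rw [div_inv_mul_sub_one ha, hab, hh]
    have : b - e ^ 2 * b = b * (1 - e ^ 2) := by ring
    rw [this]
    field_simp
  rw [natFactor, hx, add_mul, natT_sq h, hh]
  simp only [Algebra.algebraMap_eq_smul_one, smul_mul_assoc, one_mul, smul_add, smul_smul,
    inv_mul_cancel₀ he0, one_smul, sub_smul]
  abel

theorem triProd_mul_natT {n : ℕ} {w : ℕ → QField} {N : ℕ} (hN : N ≤ n)
    (h0 : ∀ i j, i < j → j < N → w i ≠ 0) (hw : ∀ i j, i < j → j < N → w i ≠ w j)
    {p : ℕ} (hp : p + 1 < N) {e : QField} (he : e = q⁻¹ ∨ e = -q)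
    (hpe : w p = e ^ 2 * w (p + 1)) :
    triProd n w N * natT n (N - p - 2) = e⁻¹ • triProd n w N := by
  obtain ⟨X, hX⟩ := triProd_right_divisible hN h0 hw hp
  rw [hX, mul_assoc, natFactor_mul_natT (by omega) he (h0 p _ (Nat.lt_succ_self p) hp) hpe,
    mul_smul_comm]

/-- A product of two factors, the first of which may be singular, is rewritten without the
singular factor when it is multiplied from the left by an eigenvector. -/
theorem mul_natFactor_mul_natFactor {n r : ℕ} {e a b c : QField} (he : e = q⁻¹ ∨ e = -q)
    (ha : a ≠ 0) (hab : a = e ^ 2 * b) (hac : a ≠ c) (hbc : b ≠ c) {G : Hecke n}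
    (hG : G * natT n r = e⁻¹ • G) :
    G * natFactor n (r + 1) a c * natFactor n r b c =
      G * natT n (r + 1) * natFactor n r b c + e • (G * natFactor n r b c) - G := by
  have he0 : e ≠ 0 := by
    rcases he with rfl | rfl
    · exact inv_ne_zero q_ne_zero
    · exact neg_ne_zero.2 q_ne_zero
  have hh : q - q⁻¹ = e⁻¹ - e := by
    rcases he with rfl | rfl
    · rw [inv_inv]
    · rw [neg_eq_neg_one_mul, mul_inv, inv_neg, inv_one]; ring
  have hb : b ≠ 0 := by rintro rfl; exact ha (by rw [hab, mul_zero])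
  -- Since `G` absorbs `natT n r` as the scalar $e^{-1}$, the pole at $a=c$ enters only through this
  -- product, and there the second bracket has a zero that cancels it.
  have hyz : (q - q⁻¹) / (a⁻¹ * c - 1) * (e⁻¹ + (q - q⁻¹) / (b⁻¹ * c - 1)) =
      e * ((q - q⁻¹) / (b⁻¹ * c - 1)) := by
    rw [div_inv_mul_sub_one ha, div_inv_mul_sub_one hb, hh]
    have h1 := sub_ne_zero.2 hac.symm
    have h2 := sub_ne_zero.2 hbc.symm
    rw [hab] at h1 ⊢
    field_simp
    ring
  unfold natFactor
  generalize (q - q⁻¹) / (a⁻¹ * c - 1) = y at *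
  generalize (q - q⁻¹) / (b⁻¹ * c - 1) = z at *
  simp only [Algebra.algebraMap_eq_smul_one, mul_add, add_mul, mul_smul_comm, smul_mul_assoc,
    mul_one, smul_add, smul_smul, hG, mul_inv_cancel₀ he0, one_smul]
  have : y • (e⁻¹ • G) + (z * y) • G = (e * z) • G := by
    rw [← hyz, smul_smul, ← add_smul]; congr 1; ring
  simp only [smul_smul] at this
  rw [← this]
  abel

/-! ### Regrouping the ordered product by rows. -/

/-- The product of `F_{j-i}(w_i, w_j)` over `i < j < N` for fixed `i`. -/
def rowProd (n : ℕ) (w : ℕ → QField) (N i : ℕ) : Hecke n :=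
  ((List.range (N - i - 1)).map fun j => natFactor n j (w i) (w (i + j + 1))).prod

theorem colProd_succ_left (n : ℕ) (w : ℕ → QField) (j p : ℕ) :
    colProd n w (j + 1) (p + 1) =
      natFactor n j (w 0) (w (j + 1)) * colProd n (fun a => w (a + 1)) j p := by
  simp only [colProd, List.range_succ_eq_map, List.map_cons, List.prod_cons, List.map_map]
  congr 3
  funext i
  simp only [Function.comp_apply, Nat.succ_eq_add_one]
  rw [Nat.add_sub_add_right]

theorem triProd_commute_natFactor (n : ℕ) (w : ℕ → QField) (N : ℕ) (a b : QField) :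
    Commute (triProd n w N) (natFactor n N a b) := by
  have : ∀ M ≤ N, Commute (triProd n w M) (natFactor n N a b) := by
    intro M
    induction M with
    | zero => exact fun _ => Commute.one_left _
    | succ M ih =>
      intro hM
      rw [triProd_succ]
      exact (ih (by omega)).mul_left
        (colProd_commute n w fun i hi => natFactor_commute n (by omega) _ _ _ _)
  exact this N le_rfl

/-- In each new column the factor of entry 0 has the largest generator index, at least two above
every index in the triangle of the remaining entries, so it commutes to the left past that triangle.
-/
theorem triProd_succ_left (n : ℕ) (w : ℕ → QField) (N : ℕ) :
    triProd n w (N + 1) = rowProd n w (N + 1) 0 * triProd n (fun a => w (a + 1)) N := by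
  induction N with
  | zero => simp [triProd, rowProd, colProd]
  | succ N ih =>
    have hr : rowProd n w (N + 1 + 1) 0 =
        rowProd n w (N + 1) 0 * natFactor n N (w 0) (w (N + 1)) := by
      simp [rowProd, List.range_succ]
    rw [triProd_succ, ih, colProd_succ_left, hr, triProd_succ n _ N]
    simp only [mul_assoc]
    rw [← mul_assoc (triProd _ _ _), (triProd_commute_natFactor n _ N _ _).eq, mul_assoc]

/-- The ordered product, with the pairs whose first member is less than `s` moved to the left. -/
theorem triProd_eq_rows_mul (n : ℕ) (w : ℕ → QField) (N s : ℕ) (hs : s ≤ N) :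
    triProd n w N =
      ((List.range s).map (rowProd n w N)).prod * triProd n (fun a => w (a + s)) (N - s) := by
  induction s with
  | zero => simp
  | succ s ih =>
    rw [ih (by omega), show N - s = N - (s + 1) + 1 by omega, triProd_succ_left, List.range_succ,
      List.map_append, List.prod_append, List.map_singleton, List.prod_singleton, mul_assoc]
    congr 2
    · simp only [rowProd, show N - (s + 1) + 1 - 0 - 1 = N - s - 1 by omega]
      refine congrArg List.prod (List.map_congr_left fun j _ => ?_)
      rw [show 0 + s = s by omega, show 0 + j + 1 + s = s + j + 1 by omega]
    · congr 1
      funext a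
      rw [show a + 1 + s = a + (s + 1) by omega]

/-! ### Regular values -/

section Regular

variable {n : ℕ} {A : Type} [Ring A] [Algebra QField A]
  {f g : (Fin n → QField) → A} {D S : Set (Fin n → QField)} {p : Fin n → QField} {v w : A}

theorem HasRegularValueAt.of_fintype {ι : Type*} [Fintype ι] (h : ι → A)
    (num : ι → MvPolynomial (Fin n) QField) (den : MvPolynomial (Fin n) QField)
    (hden : MvPolynomial.eval p den ≠ 0)
    (hf : ∀ z ∈ S, z ∈ D →
      MvPolynomial.eval z den • f z = ∑ l, MvPolynomial.eval z (num l) • h l)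
    (hv : MvPolynomial.eval p den • v = ∑ l, MvPolynomial.eval p (num l) • h l) :
    HasRegularValueAt f D S p v := by
  have e := Fintype.equivFin ι
  refine ⟨Fintype.card ι, h ∘ e.symm, num ∘ e.symm, den, hden, fun z hz hz' => ?_, ?_⟩
  · rw [hf z hz hz', ← e.symm.sum_comp]
    rfl
  · rw [eq_inv_smul_iff₀ hden, hv, ← e.symm.sum_comp]
    rfl

theorem HasRegularValueAt.congr (hf : HasRegularValueAt f D S p v)
    (h : ∀ z ∈ S, z ∈ D → g z = f z) : HasRegularValueAt g D S p v := by
  obtain ⟨r, a, num, den, hden, hfz, hv⟩ := hf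
  exact ⟨r, a, num, den, hden, fun z hz hz' => by rw [h z hz hz', hfz z hz hz'], hv⟩

theorem HasRegularValueAt.const (a : A) : HasRegularValueAt (fun _ => a) D S p a :=
  .of_fintype (ι := Unit) (fun _ => a) (fun _ => 1) 1 (by simp) (by simp) (by simp)

theorem HasRegularValueAt.rational (a : A) (num den : MvPolynomial (Fin n) QField)
    (hp : MvPolynomial.eval p den ≠ 0) (hD : ∀ z ∈ S, z ∈ D → MvPolynomial.eval z den ≠ 0) :
    HasRegularValueAt (fun z => (MvPolynomial.eval z num / MvPolynomial.eval z den) • a) D S p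
      ((MvPolynomial.eval p num / MvPolynomial.eval p den) • a) := by
  refine .of_fintype (ι := Unit) (fun _ => a) (fun _ => num) den hp (fun z hz hz' => ?_) ?_
  · rw [smul_smul, mul_div_cancel₀ _ (hD z hz hz')]
    simp
  · rw [smul_smul, mul_div_cancel₀ _ hp]
    simp

theorem HasRegularValueAt.add (hf : HasRegularValueAt f D S p v)
    (hg : HasRegularValueAt g D S p w) : HasRegularValueAt (fun z => f z + g z) D S p (v + w) := by
  obtain ⟨r, a, num, den, hden, hfz, hv⟩ := hf
  obtain ⟨r', a', num', den', hden', hgz, hw⟩ := hg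
  rw [eq_inv_smul_iff₀ hden] at hv
  rw [eq_inv_smul_iff₀ hden'] at hw
  refine .of_fintype (ι := Fin r ⊕ Fin r') (Sum.elim a a')
    (Sum.elim (fun l => den' * num l) (fun l => den * num' l)) (den * den')
    (by rw [map_mul]; exact mul_ne_zero hden hden') (fun z hz hz' => ?_) ?_
  · simp only [Fintype.sum_sum_type, Sum.elim_inl, Sum.elim_inr, map_mul, mul_smul,
      ← Finset.smul_sum, ← hfz z hz hz', ← hgz z hz hz', smul_add]
    rw [smul_comm (MvPolynomial.eval z den') (MvPolynomial.eval z den) (f z)]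
  · simp only [Fintype.sum_sum_type, Sum.elim_inl, Sum.elim_inr, map_mul, mul_smul,
      ← Finset.smul_sum, ← hv, ← hw, smul_add]
    rw [smul_comm (MvPolynomial.eval p den') (MvPolynomial.eval p den) v]

theorem HasRegularValueAt.mul (hf : HasRegularValueAt f D S p v)
    (hg : HasRegularValueAt g D S p w) : HasRegularValueAt (fun z => f z * g z) D S p (v * w) := by
  obtain ⟨r, a, num, den, hden, hfz, hv⟩ := hf
  obtain ⟨r', a', num', den', hden', hgz, hw⟩ := hg
  rw [eq_inv_smul_iff₀ hden] at hv
  rw [eq_inv_smul_iff₀ hden'] at hw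
  refine .of_fintype (ι := Fin r × Fin r') (fun l => a l.1 * a' l.2)
    (fun l => num l.1 * num' l.2) (den * den')
    (by rw [map_mul]; exact mul_ne_zero hden hden') (fun z hz hz' => ?_) ?_
  · rw [map_mul, ← smul_mul_smul_comm, hfz z hz hz', hgz z hz hz', Finset.sum_mul_sum,
      Fintype.sum_prod_type]
    simp only [map_mul, smul_mul_smul_comm]
  · rw [map_mul, ← smul_mul_smul_comm, hv, hw, Finset.sum_mul_sum, Fintype.sum_prod_type]
    simp only [map_mul, smul_mul_smul_comm]

/-- Pulling back along a map of indices and pushing forward along an algebra homomorphism. -/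
theorem HasRegularValueAt.comp {m : ℕ} {B : Type} [Ring B] [Algebra QField B]
    {D' S' : Set (Fin m → QField)} {f : (Fin m → QField) → A} (σ : Fin m → Fin n)
    (φ : A →ₐ[QField] B) (hf : HasRegularValueAt f D' S' (p ∘ σ) v)
    (hS : ∀ z ∈ S, z ∘ σ ∈ S') (hD : ∀ z ∈ D, z ∘ σ ∈ D') :
    HasRegularValueAt (fun z => φ (f (z ∘ σ))) D S p (φ v) := by
  obtain ⟨r, a, num, den, hden, hfz, hv⟩ := hf
  rw [eq_inv_smul_iff₀ hden] at hv
  refine .of_fintype (ι := Fin r) (fun l => φ (a l))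
    (fun l => MvPolynomial.rename σ (num l)) (MvPolynomial.rename σ den)
    (by rwa [MvPolynomial.eval_rename]) (fun z hz hz' => ?_) ?_
  · simp only [MvPolynomial.eval_rename, ← map_smul, ← map_sum, hfz _ (hS z hz) (hD z hz')]
  · simp only [MvPolynomial.eval_rename, ← map_smul, ← map_sum, hv]

/-- The function `f` is regular at all points of `E`, with one and the same value. -/
def RegularOn (f : (Fin n → QField) → A) (D S E : Set (Fin n → QField)) : Prop :=
  ∃ v, ∀ p ∈ E, HasRegularValueAt f D S p v

variable {E : Set (Fin n → QField)}

theorem RegularOn.congr (hf : RegularOn f D S E) (h : ∀ z ∈ S, z ∈ D → g z = f z) :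
    RegularOn g D S E :=
  hf.imp fun _ hv p hp => (hv p hp).congr h

theorem RegularOn.const (a : A) : RegularOn (fun _ => a) D S E := ⟨a, fun _ _ => .const a⟩

theorem RegularOn.add (hf : RegularOn f D S E) (hg : RegularOn g D S E) :
    RegularOn (fun z => f z + g z) D S E := by
  obtain ⟨v, hv⟩ := hf
  obtain ⟨w, hw⟩ := hg
  exact ⟨v + w, fun p hp => (hv p hp).add (hw p hp)⟩

theorem RegularOn.mul (hf : RegularOn f D S E) (hg : RegularOn g D S E) :
    RegularOn (fun z => f z * g z) D S E := by
  obtain ⟨v, hv⟩ := hf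
  obtain ⟨w, hw⟩ := hg
  exact ⟨v * w, fun p hp => (hv p hp).mul (hw p hp)⟩

theorem RegularOn.smul (c : QField) (hf : RegularOn f D S E) :
    RegularOn (fun z => c • f z) D S E := by
  refine ((RegularOn.const (algebraMap QField A c)).mul hf).congr fun z _ _ => ?_
  rw [Algebra.smul_def]

theorem RegularOn.list_prod {ι : Type*} {f : ι → (Fin n → QField) → A} {l : List ι}
    (h : ∀ i ∈ l, RegularOn (f i) D S E) :
    RegularOn (fun z => (l.map fun i => f i z).prod) D S E := by
  induction l with
  | nil => exact RegularOn.const 1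
  | cons i l ih =>
    refine ((h i (by simp)).mul (ih fun j hj => h j (by simp [hj]))).congr fun z _ _ => ?_
    rw [List.map_cons, List.prod_cons]

end Regular

/-! ### Points of a subspace at which finitely many polynomials do not vanish -/

/-- A linear subspace over an infinite field is irreducible. On the line through a good point for
`f` and a good point for `g` both restrict to nonzero univariate polynomials, whose product has a
nonzero value somewhere. -/
theorem exists_mem_eval_mul_ne_zero {K σ : Type*} [Field K] [Infinite K]
    (S : Submodule K (σ → K)) {f g : MvPolynomial σ K} (hf : ∃ z ∈ S, MvPolynomial.eval z f ≠ 0)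
    (hg : ∃ z ∈ S, MvPolynomial.eval z g ≠ 0) : ∃ z ∈ S, MvPolynomial.eval z (f * g) ≠ 0 := by
  obtain ⟨x, hx, hfx⟩ := hf
  obtain ⟨y, hy, hgy⟩ := hg
  let line : σ → Polynomial K := fun a => Polynomial.C (x a) + Polynomial.X * Polynomial.C (y a - x a)
  have hline : ∀ (u : K) (P : MvPolynomial σ K), Polynomial.eval u (MvPolynomial.aeval line P) =
      MvPolynomial.eval (x + u • (y - x)) P := by
    intro u P
    have : (Polynomial.evalRingHom u).comp ((MvPolynomial.aeval line).toRingHom) =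
        MvPolynomial.eval (x + u • (y - x)) := by
      apply MvPolynomial.ringHom_ext
      · intro c
        simp
      · intro a
        simp [line]
    exact congrArg (fun F => F P) this
  have h0 : MvPolynomial.aeval line f * MvPolynomial.aeval line g ≠ 0 := by
    refine mul_ne_zero (fun h => hfx ?_) (fun h => hgy ?_)
    · have := hline 0 f
      rw [h] at this
      simpa using this.symm
    · have := hline 1 g
      rw [h] at this
      simpa using this.symm
  obtain ⟨u, hu⟩ := Polynomial.exists_eval_ne_zero_of_natDegree_lt_card _ h0
    (Cardinal.natCast_lt_aleph0.trans_le (Cardinal.aleph0_le_mk _))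
  refine ⟨x + u • (y - x), S.add_mem hx (S.smul_mem u (S.sub_mem hy hx)), ?_⟩
  rw [map_mul, ← hline, ← hline, ← Polynomial.eval_mul]
  exact hu

theorem exists_mem_eval_ne_zero {K σ ι : Type*} [Field K] [Infinite K]
    (S : Submodule K (σ → K)) (s : Finset ι) (f : ι → MvPolynomial σ K)
    (hf : ∀ i ∈ s, ∃ z ∈ S, MvPolynomial.eval z (f i) ≠ 0) :
    ∃ z ∈ S, ∀ i ∈ s, MvPolynomial.eval z (f i) ≠ 0 := by
  classical
  suffices ∃ z ∈ S, MvPolynomial.eval z (∏ i ∈ s, f i) ≠ 0 by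
    obtain ⟨z, hz, h⟩ := this
    rw [map_prod] at h
    exact ⟨z, hz, fun i hi => Finset.prod_ne_zero_iff.1 h i hi⟩
  induction s using Finset.induction_on with
  | empty => exact ⟨0, S.zero_mem, by simp⟩
  | insert i s hi ih =>
    rw [Finset.prod_insert hi]
    exact exists_mem_eval_mul_ne_zero S (hf i (by simp)) (ih fun j hj => hf j (by simp [hj]))

/-- The value is determined if the domain of definition contains the set where finitely many
polynomials, none of which vanishes on `S`, do not vanish. -/
theorem HasRegularValueAt.unique {n : ℕ} {A ι : Type} [Ring A] [Algebra QField A] [Fintype ι]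
    {f : (Fin n → QField) → A} {D : Set (Fin n → QField)} {S : Submodule QField (Fin n → QField)}
    {p : Fin n → QField} {v w : A} (hp : p ∈ S) (δ : ι → MvPolynomial (Fin n) QField)
    (hδ : ∀ i, ∃ z ∈ S, MvPolynomial.eval z (δ i) ≠ 0)
    (hD : ∀ z ∈ S, (∀ i, MvPolynomial.eval z (δ i) ≠ 0) → z ∈ D)
    (hv : HasRegularValueAt f D S p v) (hw : HasRegularValueAt f D S p w) : v = w := by
  by_contra hne
  obtain ⟨r, a, num, den, hden, hfz, hv⟩ := hv
  obtain ⟨r', a', num', den', hden', hgz, hw⟩ := hw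
  rw [eq_inv_smul_iff₀ hden] at hv
  rw [eq_inv_smul_iff₀ hden'] at hw
  -- A functional that separates `v` from `w` reduces the claim to scalar polynomials: `Q` is the
  -- image of the cross-multiplied difference of the two fractions, and its value at `p` is a
  -- nonzero multiple of `φ (v - w)`.
  obtain ⟨φ, hφ⟩ : ∃ φ : Module.Dual QField A, φ (v - w) ≠ 0 := by
    by_contra! h
    exact hne (sub_eq_zero.1 ((Module.forall_dual_apply_eq_zero_iff QField _).1 h))
  let Q : MvPolynomial (Fin n) QField :=
    den' * ∑ l, num l * MvPolynomial.C (φ (a l)) - den * ∑ l, num' l * MvPolynomial.C (φ (a' l))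
  have hQ : ∀ z, MvPolynomial.eval z Q =
      φ (MvPolynomial.eval z den' • ∑ l, MvPolynomial.eval z (num l) • a l -
        MvPolynomial.eval z den • ∑ l, MvPolynomial.eval z (num' l) • a' l) := by
    intro z
    simp [Q, map_sum]
  have hQp : MvPolynomial.eval p Q ≠ 0 := by
    rw [hQ, ← hv, ← hw, smul_comm, ← smul_sub, ← smul_sub, map_smul, map_smul, smul_eq_mul,
      smul_eq_mul]
    exact mul_ne_zero hden (mul_ne_zero hden' hφ)
  -- At a point of the domain both fractions represent `f`, so `Q` vanishes there; irreducibility of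
  -- `S` supplies a point of the domain where it does not.
  obtain ⟨z, hz, h⟩ := exists_mem_eval_ne_zero S (Finset.univ : Finset (Option ι))
    (fun o => o.elim Q δ) (by
      rintro (_ | i) -
      · exact ⟨p, hp, hQp⟩
      · exact hδ i)
  have hzD : z ∈ D := hD z hz fun i => h (some i) (Finset.mem_univ _)
  refine h none (Finset.mem_univ _) ?_
  simp only [Option.elim]
  rw [hQ, ← hfz z hz hzD, ← hgz z hz hzD, smul_comm, sub_self, map_zero]

/-! ### The parameters of the fusion product -/

section Weights

variable {lam : YoungDiagram} (L : StandardTableau lam)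

/-- The parameters `q ^ {2 c_a} z_a`, extended by zero to all natural numbers. -/
def natWeight (z : Fin lam.card → QField) (a : ℕ) : QField :=
  if h : a < lam.card then weight L z ⟨a, h⟩ else 0

/-- The parameters as polynomials. -/
def weightPoly (a : Fin lam.card) : MvPolynomial (Fin lam.card) QField :=
  MvPolynomial.C (q ^ (2 * L.content a)) * MvPolynomial.X a

theorem eval_weightPoly (z : Fin lam.card → QField) (a : Fin lam.card) :
    MvPolynomial.eval z (weightPoly L a) = weight L z a := by
  simp [weightPoly, weight]

theorem natWeight_coe (z : Fin lam.card → QField) (a : Fin lam.card) :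
    natWeight L z a = weight L z a := dif_pos a.2

theorem fusionProduct_eq_triProd (z : Fin lam.card → QField) :
    fusionProduct L z = triProd lam.card (natWeight L z) lam.card := by
  simp only [fusionProduct, triProd, colProd]
  conv_rhs => rw [← List.map_coe_finRange_eq_range, List.map_map]
  refine congrArg List.prod (List.map_congr_left fun j _ => ?_)
  simp only [Function.comp_apply]
  conv_rhs => rw [← List.map_coe_finRange_eq_range, List.map_map]
  refine congrArg List.prod (List.map_congr_left fun i _ => ?_)
  have hi : (i : ℕ) < lam.card := i.2.trans j.2
  have hr : (j : ℕ) - i - 1 < lam.card - 1 := by omega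
  simp only [Function.comp_apply, natFactor, factor, natT, dif_pos hr, natWeight_coe]
  rw [show natWeight L z i = weight L z ⟨i, hi⟩ from dif_pos hi]

theorem natWeight_ne_zero {z : Fin lam.card → QField} (hz : z ∈ domain L) {i j : ℕ} (hij : i < j)
    (hj : j < lam.card) : natWeight L z i ≠ 0 := by
  have h := (hz ⟨i, hij.trans hj⟩ ⟨j, hj⟩ hij).1
  rwa [← natWeight_coe] at h

theorem natWeight_ne {z : Fin lam.card → QField} (hz : z ∈ domain L) {i j : ℕ} (hij : i < j)
    (hj : j < lam.card) : natWeight L z i ≠ natWeight L z j := by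
  have h := (hz ⟨i, hij.trans hj⟩ ⟨j, hj⟩ hij).2
  rwa [← natWeight_coe, ← natWeight_coe] at h

/-- A factor is regular where its two parameters differ; the value depends on their ratio only. -/
theorem natFactor_regularOn (n r : ℕ) {S E : Set (Fin lam.card → QField)} {i j : Fin lam.card}
    (hij : i < j) (hE : ∀ p ∈ E, weight L p i ≠ weight L p j)
    (hc : ∀ p ∈ E, ∀ p' ∈ E, weight L p i / (weight L p j - weight L p i) =
      weight L p' i / (weight L p' j - weight L p' i)) :
    RegularOn (fun z => natFactor n r (natWeight L z i) (natWeight L z j)) (domain L) S E := by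
  have hr : RegularOn (fun z => (MvPolynomial.eval z (weightPoly L i) /
      MvPolynomial.eval z (weightPoly L j - weightPoly L i)) •
        algebraMap QField (Hecke n) (q - q⁻¹)) (domain L) S E := by
    -- The common value is read off at a sample point, which requires `E` to be nonempty.
    rcases E.eq_empty_or_nonempty with rfl | ⟨p₀, hp₀⟩
    · exact ⟨0, fun p hp => hp.elim⟩
    · refine ⟨(weight L p₀ i / (weight L p₀ j - weight L p₀ i)) •
        algebraMap QField (Hecke n) (q - q⁻¹), fun p hp => ?_⟩
      · have := HasRegularValueAt.rational (D := domain L) (S := S) (p := p)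
          (algebraMap QField (Hecke n) (q - q⁻¹))
          (weightPoly L i) (weightPoly L j - weightPoly L i) ?_ ?_
        · simp only [map_sub (MvPolynomial.eval p), eval_weightPoly] at this
          rw [hc p hp p₀ hp₀] at this
          simpa only [map_sub (MvPolynomial.eval _), eval_weightPoly] using this
        · rw [map_sub, eval_weightPoly, eval_weightPoly]
          exact sub_ne_zero.2 (hE p hp).symm
        · intro z _ hz
          rw [map_sub, eval_weightPoly, eval_weightPoly]
          exact sub_ne_zero.2 (hz i j hij).2.symm
  refine ((RegularOn.const (natT n r)).add hr).congr fun z _ hz => ?_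
  have h0 : weight L z i ≠ 0 := (hz i j hij).1
  rw [natFactor, natWeight_coe, natWeight_coe, div_inv_mul_sub_one h0, mul_comm, map_mul,
    Algebra.smul_def, map_sub (MvPolynomial.eval z), eval_weightPoly, eval_weightPoly]

theorem natFactor_regularOn_singleton (n r : ℕ) {S : Set (Fin lam.card → QField)}
    {p : Fin lam.card → QField} {i j : Fin lam.card} (hij : i < j)
    (hp : weight L p i ≠ weight L p j) :
    RegularOn (fun z => natFactor n r (natWeight L z i) (natWeight L z j)) (domain L) S {p} :=
  natFactor_regularOn L n r hij (fun _ h => h ▸ hp) fun _ h _ h' => h ▸ h' ▸ rfl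

theorem weight_ne_of_content_ne {t : QField} (ht : t ≠ 0) {i j : Fin lam.card}
    (h : L.content i ≠ L.content j) : weight L (fun _ => t) i ≠ weight L (fun _ => t) j :=
  fun h' => q_zpow_two_mul_ne h (mul_right_cancel₀ ht h')

theorem natFactor_regularOn_diagonal (n r : ℕ) {S : Set (Fin lam.card → QField)}
    {i j : Fin lam.card} (hij : i < j) (hc : L.content i ≠ L.content j) :
    RegularOn (fun z => natFactor n r (natWeight L z i) (natWeight L z j)) (domain L) S
      {p | ∃ t : QField, t ≠ 0 ∧ p = fun _ => t} := by
  refine natFactor_regularOn L n r hij ?_ ?_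
  · rintro p ⟨t, ht, rfl⟩
    exact weight_ne_of_content_ne L ht hc
  · rintro p ⟨t, ht, rfl⟩ p' ⟨t', ht', rfl⟩
    simp only [weight, ← sub_mul]
    rw [mul_div_mul_right _ _ ht, mul_div_mul_right _ _ ht']

/-- If every entry `a` that has the content of a later entry `b` is followed, before `b`, by an
entry of the same hook with the next or the previous content, then the fusion product is regular
at the diagonal. -/
theorem exists_isFusionValue
    (hL : ∀ a b : Fin lam.card, a < b → L.content a = L.content b →
      ∃ a' : Fin lam.card, (a' : ℕ) = a + 1 ∧ a' < b ∧
        (L.content a' = L.content a + 1 ∨ L.content a' = L.content a - 1) ∧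
        ∀ z ∈ hookSubspace L, z a' = z a) :
    ∃ v, IsFusionValue L v := by
  -- One value is carried along the whole diagonal, so its independence of `t` results from the same
  -- induction as regularity.
  let E : Set (Fin lam.card → QField) := {p | ∃ t : QField, t ≠ 0 ∧ p = fun _ => t}
  have main : ∀ N ≤ lam.card, RegularOn (fun z => triProd lam.card (natWeight L z) N)
      (domain L) (hookSubspace L) E := by
    intro N
    induction N with
    | zero => exact fun _ => RegularOn.const 1
    | succ N ih =>
      intro hN
      have ih := ih (by omega)
      let b : Fin lam.card := ⟨N, hN⟩
      -- A partial column is considered only if its last factor is nonsingular at the diagonal; a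
      -- singular factor is always taken together with its successor.
      have col : ∀ P (hP : P ≤ N), (∀ a : Fin lam.card, (a : ℕ) + 1 = P →
            L.content a ≠ L.content b) →
          RegularOn (fun z => triProd lam.card (natWeight L z) N * colProd lam.card (natWeight L z) N P)
            (domain L) (hookSubspace L) E := by
        intro P
        induction P using Nat.strong_induction_on with
        | _ P ihP =>
          intro hP hPc
          rcases P with _ | P
          · exact ih.mul (RegularOn.const 1)
          · have hPn : P < lam.card := by omega
            have hPb : (⟨P, hPn⟩ : Fin lam.card) < b := hP
            have hlast := natFactor_regularOn_diagonal L lam.card (N - P - 1)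
              (S := hookSubspace L) hPb (hPc ⟨P, hPn⟩ rfl)
            by_cases hprev : ∀ a : Fin lam.card, (a : ℕ) + 1 = P → L.content a ≠ L.content b
            · refine ((ihP P (by omega) (by omega) hprev).mul hlast).congr fun z _ _ => ?_
              rw [colProd_succ, mul_assoc]
            · push Not at hprev
              obtain ⟨a, ha, hab⟩ := hprev
              obtain rfl : P = a + 1 := ha.symm
              have haN : (a : ℕ) < N := by omega
              obtain ⟨a', ha', ha'b, hca', hza'⟩ := hL a b haN hab
              -- The factor before the singular one is nonsingular: otherwise the content of `a`
              -- would differ by one from that of its predecessor `c`, although both equal that of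
              -- `b`.
              have hbefore := ihP a (by omega) (by omega) (by
                intro c hc hcb
                obtain ⟨c', hc', -, hcc', -⟩ := hL c b (show (c : ℕ) < N by omega) hcb
                have : c' = a := Fin.ext (by omega)
                subst this
                omega)
              obtain ⟨e, he, hw⟩ : ∃ e : QField, (e = q⁻¹ ∨ e = -q) ∧
                  ∀ z ∈ hookSubspace L, natWeight L z a = e ^ 2 * natWeight L z (a + 1) := by
                have hq := q_ne_zero
                rcases hca' with h | h
                · refine ⟨q⁻¹, Or.inl rfl, fun z hz => ?_⟩
                  rw [← ha', natWeight_coe, natWeight_coe, weight, weight, hza' z hz, h, mul_add,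
                    zpow_add₀ hq]
                  rw [mul_one, show q ^ (2 : ℤ) = q ^ 2 from zpow_ofNat q 2]
                  field_simp
                · refine ⟨-q, Or.inr rfl, fun z hz => ?_⟩
                  rw [← ha', natWeight_coe, natWeight_coe, weight, weight, hza' z hz, h, mul_sub,
                    zpow_sub₀ hq]
                  rw [mul_one, show q ^ (2 : ℤ) = q ^ 2 from zpow_ofNat q 2]
                  field_simp
              have hreg := (((hbefore.mul (RegularOn.const (natT lam.card (N - a - 2 + 1)))).mul
                hlast).add ((hbefore.mul hlast).smul e)).add (hbefore.smul (-1))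
              refine hreg.congr fun z hz hzD => ?_
              have h1 : N - a - 1 = N - a - 2 + 1 := by omega
              have h2 : N - (a + 1) - 1 = N - a - 2 := by omega
              have hG : triProd lam.card (natWeight L z) N * colProd lam.card (natWeight L z) N a *
                  natT lam.card (N - a - 2) =
                  e⁻¹ • (triProd lam.card (natWeight L z) N *
                    colProd lam.card (natWeight L z) N a) := by
                -- The factors of the column before `a` have indices at least `N - a`, two above the
                -- index of this generator.
                have hc : Commute (colProd lam.card (natWeight L z) N a)
                    (natT lam.card (N - a - 2)) :=
                  colProd_commute _ _ fun i hi => natFactor_commute_natT _ (by omega) _ _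
                rw [mul_assoc, hc.eq, ← mul_assoc, triProd_mul_natT (by omega)
                  (fun i j hi hj => natWeight_ne_zero L hzD hi (by omega))
                  (fun i j hi hj => natWeight_ne L hzD hi (by omega)) (by omega) he (hw z hz),
                  smul_mul_assoc]
              have hfin := mul_natFactor_mul_natFactor he
                (natWeight_ne_zero L hzD haN hN) (hw z hz)
                (natWeight_ne L hzD haN hN) (natWeight_ne L hzD hP hN) hG
              rw [colProd_succ, colProd_succ, h1, h2, ← mul_assoc, ← mul_assoc, hfin, neg_smul,
                one_smul, sub_eq_add_neg]
      refine (col N le_rfl ?_).congr fun z _ _ => triProd_succ _ _ _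
      -- The last entry before `N` cannot share its content, since the next entry `a'` must still
      -- precede `N`.
      intro a ha hab
      obtain ⟨a', ha', hlt, -, -⟩ := hL a b (show (a : ℕ) < N by omega) hab
      have : (a' : ℕ) < N := hlt
      omega
  obtain ⟨v, hv⟩ := main lam.card le_rfl
  exact ⟨v, fun t ht => (hv _ ⟨t, ht, rfl⟩).congr fun z _ _ => fusionProduct_eq_triProd L z⟩

end Weights

/-! ### Combinatorics of the hook tableau -/

/-- The index of the principal hook that contains the entry `a`. -/
def StandardTableau.hookIndex {lam : YoungDiagram} (L : StandardTableau lam)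
    (a : Fin lam.card) : ℕ :=
  min (L.box a).1.1 (L.box a).1.2

theorem mem_hookSubspace_iff {lam : YoungDiagram} (L : StandardTableau lam)
    (z : Fin lam.card → QField) :
    z ∈ hookSubspace L ↔ ∀ a b, L.hookIndex a = L.hookIndex b → z a = z b := by
  have key : ∀ (a : Fin lam.card) (p : ℕ),
      (L.box a).1 ∈ principalHook lam p ↔ L.hookIndex a = p := by
    intro a p
    simp only [principalHook, Finset.mem_filter, StandardTableau.hookIndex]
    have := (L.box a).2
    simp only [this, true_and]
    omega
  change (∀ (p : ℕ) (a b : Fin lam.card), _ → _ → z a = z b) ↔ _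
  simp only [key]
  exact ⟨fun h a b hab => h _ a b hab rfl, fun h p a b ha hb => h a b (ha.trans hb.symm)⟩

/-- A principal hook meets each diagonal at most once: the box $(i,j)$ is determined by $\min(i,j)$
and $j-i$. -/
theorem eq_of_hookIndex_eq_of_content_eq {lam : YoungDiagram} (L : StandardTableau lam)
    {a b : Fin lam.card} (h : L.hookIndex a = L.hookIndex b) (hc : L.content a = L.content b) :
    a = b := by
  apply L.box.injective
  apply Subtype.ext
  simp only [StandardTableau.hookIndex, StandardTableau.content] at h hc
  apply Prod.ext <;> omega

section HookTableau

variable (lam : YoungDiagram)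

theorem hookEntry_box (a : Fin lam.card) : hookEntry lam ((hookTableau lam).box a).1 = a :=
  congrArg Fin.val (Equiv.ofBijective_apply_symm_apply (hookFilling lam)
    (hookFilling_bijective lam) a)

theorem box_eq_of_hookEntry_eq {a : Fin lam.card} {b : ℕ × ℕ} (hb : b ∈ lam.cells)
    (h : hookEntry lam b = a) : ((hookTableau lam).box a).1 = b := by
  have : (hookTableau lam).box a = ⟨b, hb⟩ := by
    change (Equiv.ofBijective (hookFilling lam) (hookFilling_bijective lam)).symm a = _
    rw [Equiv.symm_apply_eq]
    exact Fin.ext h.symm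
  rw [this]

theorem hookKey_box_le {a b : Fin lam.card} (h : a ≤ b) :
    hookKey ((hookTableau lam).box a).1 ≤ hookKey ((hookTableau lam).box b).1 := by
  by_contra! hlt
  have := hookEntry_strict lam ((hookTableau lam).box b).2 hlt
  rw [hookEntry_box, hookEntry_box] at this
  exact absurd h (not_le.2 this)

theorem hookIndex_mono {a b : Fin lam.card} (h : a ≤ b) :
    (hookTableau lam).hookIndex a ≤ (hookTableau lam).hookIndex b := by
  by_contra! hlt
  refine absurd (hookKey_box_le lam h) (not_le.2 ?_)
  rw [hookKey_lt_iff]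
  exact Or.inl hlt

/-- The box filled right after `b`, as far as it lies in the same part of the same hook. -/
theorem hookEntry_next {b b' : ℕ × ℕ} (hb : b ∈ lam.cells)
    (h : (b.2 ≤ b.1 ∧ b' = (b.1 + 1, b.2)) ∨ (b.1 < b.2 ∧ b' = (b.1, b.2 + 1))) :
    hookEntry lam b' = hookEntry lam b + 1 := by
  have : (lam.cells.filter fun c => hookKey c < hookKey b') =
      insert b (lam.cells.filter fun c => hookKey c < hookKey b) := by
    ext c
    have key : hookKey c < hookKey b' ↔ c = b ∨ hookKey c < hookKey b := by
      rw [hookKey_lt_iff, hookKey_lt_iff, Prod.ext_iff]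
      rcases h with ⟨h, rfl⟩ | ⟨h, rfl⟩ <;> grind
    simp only [Finset.mem_filter, Finset.mem_insert, key]
    constructor
    · rintro ⟨hc, rfl | hc'⟩
      · exact Or.inl rfl
      · exact Or.inr ⟨hc, hc'⟩
    · rintro (rfl | ⟨hc, hc'⟩)
      · exact ⟨hb, Or.inl rfl⟩
      · exact ⟨hc, Or.inr hc'⟩
  rw [hookEntry, this, Finset.card_insert_of_notMem (by simp), hookEntry]

/-- Equal contents force `b` into a later hook, so its box lies strictly below and strictly to the
right of that of `a` on the same diagonal. Hence both the lower and the right neighbour of the box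
of `a` belong to the diagram, and one of them is filled immediately after it. -/
theorem hookTableau_next (a b : Fin lam.card) (hab : a < b)
    (hc : (hookTableau lam).content a = (hookTableau lam).content b) :
    ∃ a' : Fin lam.card, (a' : ℕ) = a + 1 ∧ a' < b ∧
      ((hookTableau lam).content a' = (hookTableau lam).content a + 1 ∨
        (hookTableau lam).content a' = (hookTableau lam).content a - 1) ∧
      ∀ z ∈ hookSubspace (hookTableau lam), z a' = z a := by
  have hidx : (hookTableau lam).hookIndex a < (hookTableau lam).hookIndex b :=
    lt_of_le_of_ne (hookIndex_mono lam hab.le) fun h =>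
      hab.ne (eq_of_hookIndex_eq_of_content_eq _ h hc)
  have hbmem := ((hookTableau lam).box b).2
  have hamem := ((hookTableau lam).box a).2
  obtain ⟨c, hcmem, hnext⟩ : ∃ c ∈ lam.cells,
      (((hookTableau lam).box a).1.2 ≤ ((hookTableau lam).box a).1.1 ∧
        c = (((hookTableau lam).box a).1.1 + 1, ((hookTableau lam).box a).1.2)) ∨
      (((hookTableau lam).box a).1.1 < ((hookTableau lam).box a).1.2 ∧
        c = (((hookTableau lam).box a).1.1, ((hookTableau lam).box a).1.2 + 1)) := by
    simp only [StandardTableau.hookIndex, StandardTableau.content] at hidx hc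
    rcases Nat.lt_or_ge ((hookTableau lam).box a).1.1 ((hookTableau lam).box a).1.2 with h | h
    · exact ⟨_, lam.isLowerSet (Prod.mk_le_mk.2 ⟨by omega, by omega⟩ :
        (((hookTableau lam).box a).1.1, ((hookTableau lam).box a).1.2 + 1) ≤
          (((hookTableau lam).box b).1.1, ((hookTableau lam).box b).1.2)) hbmem, Or.inr ⟨h, rfl⟩⟩
    · exact ⟨_, lam.isLowerSet (Prod.mk_le_mk.2 ⟨by omega, by omega⟩ :
        (((hookTableau lam).box a).1.1 + 1, ((hookTableau lam).box a).1.2) ≤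
          (((hookTableau lam).box b).1.1, ((hookTableau lam).box b).1.2)) hbmem, Or.inl ⟨h, rfl⟩⟩
  have he := hookEntry_next lam hamem hnext
  rw [hookEntry_box] at he
  have hlt := hookEntry_lt lam c hcmem
  rw [he] at hlt
  have hbox : ((hookTableau lam).box ⟨a + 1, hlt⟩).1 = c := box_eq_of_hookEntry_eq lam hcmem he
  have hcont : (hookTableau lam).content ⟨a + 1, hlt⟩ = (hookTableau lam).content a + 1 ∨
      (hookTableau lam).content ⟨a + 1, hlt⟩ = (hookTableau lam).content a - 1 := by
    simp only [StandardTableau.content, hbox]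
    rcases hnext with ⟨-, rfl⟩ | ⟨-, rfl⟩ <;> push_cast <;> omega
  refine ⟨⟨a + 1, hlt⟩, rfl, ?_, hcont, ?_⟩
  · refine lt_of_le_of_ne (Fin.mk_le_of_le_val (by exact hab)) ?_
    rintro rfl
    omega
  · intro z hz
    refine (mem_hookSubspace_iff _ z).1 hz _ _ ?_
    simp only [StandardTableau.hookIndex, hbox]
    rcases hnext with ⟨h, rfl⟩ | ⟨h, rfl⟩ <;> simp only <;> omega

/-! ### Position of the smaller hook tableau inside the larger one. -/

theorem mem_cells_shift (k : ℕ) (b : ℕ × ℕ) :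
    (b.1 + k, b.2 + k) ∈ lam.cells ↔ b ∈ (removeHooks lam k).cells :=
  (mem_removeHooks lam k b).symm

theorem hookKey_shift_lt_iff (k : ℕ) (b c : ℕ × ℕ) :
    hookKey (b.1 + k, b.2 + k) < hookKey (c.1 + k, c.2 + k) ↔ hookKey b < hookKey c := by
  rw [hookKey_lt_iff, hookKey_lt_iff]
  grind

/-- All boxes of the removed hooks are filled before any other box; the added constant is their
number. -/
theorem hookEntry_shift (k : ℕ) (b : ℕ × ℕ) :
    hookEntry lam (b.1 + k, b.2 + k) =
      hookEntry (removeHooks lam k) b + (lam.card - (removeHooks lam k).card) := by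
  let s : ℕ × ℕ → ℕ × ℕ := fun b => (b.1 + k, b.2 + k)
  have hsub : (removeHooks lam k).cells.image s ⊆ lam.cells := by
    intro c hc
    obtain ⟨d, hd, rfl⟩ := Finset.mem_image.1 hc
    exact (mem_cells_shift lam k d).2 hd
  have hsplit : (lam.cells.filter fun c => hookKey c < hookKey (s b)) =
      ((removeHooks lam k).cells.filter fun c => hookKey c < hookKey b).image s ∪
        (lam.cells \ (removeHooks lam k).cells.image s) := by
    ext c
    simp only [Finset.mem_filter, Finset.mem_union, Finset.mem_image, Finset.mem_sdiff]
    constructor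
    · rintro ⟨hc, hlt⟩
      by_cases h : ∃ d ∈ (removeHooks lam k).cells, s d = c
      · obtain ⟨d, hd, rfl⟩ := h
        exact Or.inl ⟨d, ⟨hd, (hookKey_shift_lt_iff k d b).1 hlt⟩, rfl⟩
      · exact Or.inr ⟨hc, h⟩
    · rintro (⟨d, ⟨hd, hlt⟩, rfl⟩ | ⟨hc, h⟩)
      · exact ⟨(mem_cells_shift lam k d).2 hd, (hookKey_shift_lt_iff k d b).2 hlt⟩
      · refine ⟨hc, ?_⟩
        have hk : c.1 < k ∨ c.2 < k := by
          by_contra! hge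
          have e : ((c.1 - k) + k, (c.2 - k) + k) = c := by
            rw [Nat.sub_add_cancel hge.1, Nat.sub_add_cancel hge.2]
          exact h ⟨(c.1 - k, c.2 - k), (mem_cells_shift lam k _).1 (by rw [e]; exact hc), e⟩
        rw [hookKey_lt_iff]
        left
        simp only [s]
        omega
  have hdisj : Disjoint (((removeHooks lam k).cells.filter fun c => hookKey c < hookKey b).image s)
      (lam.cells \ (removeHooks lam k).cells.image s) := by
    refine Finset.disjoint_of_subset_left (Finset.image_subset_image (Finset.filter_subset _ _)) ?_
    exact Finset.disjoint_sdiff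
  have hinj : Function.Injective s := shift_injective k
  change (lam.cells.filter fun c => hookKey c < hookKey (s b)).card = _
  rw [hsplit, Finset.card_union_of_disjoint hdisj, Finset.card_image_of_injective _ hinj,
    Finset.card_sdiff_of_subset hsub, Finset.card_image_of_injective _ hinj]
  rfl

/-- The entry of `lam` that corresponds to an entry of the diagram left after the removal of the
first `k` principal hooks. -/
def shiftEntry (k : ℕ) (a : Fin (removeHooks lam k).card) : Fin lam.card :=
  ⟨a + (lam.card - (removeHooks lam k).card), by
    have := card_removeHooks_le lam k
    omega⟩

theorem box_shiftEntry (k : ℕ) (a : Fin (removeHooks lam k).card) :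
    ((hookTableau lam).box (shiftEntry lam k a)).1 =
      (((hookTableau (removeHooks lam k)).box a).1.1 + k,
        ((hookTableau (removeHooks lam k)).box a).1.2 + k) := by
  refine box_eq_of_hookEntry_eq lam
    ((mem_cells_shift lam k _).2 ((hookTableau (removeHooks lam k)).box a).2) ?_
  rw [hookEntry_shift, hookEntry_box]
  rfl

theorem content_shiftEntry (k : ℕ) (a : Fin (removeHooks lam k).card) :
    (hookTableau lam).content (shiftEntry lam k a) =
      (hookTableau (removeHooks lam k)).content a := by
  simp only [StandardTableau.content, box_shiftEntry]
  push_cast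
  ring

theorem hookIndex_shiftEntry (k : ℕ) (a : Fin (removeHooks lam k).card) :
    (hookTableau lam).hookIndex (shiftEntry lam k a) =
      (hookTableau (removeHooks lam k)).hookIndex a + k := by
  simp only [StandardTableau.hookIndex, box_shiftEntry]
  omega

theorem hookIndex_lt_of_lt (k : ℕ) (a : Fin lam.card)
    (h : (a : ℕ) < lam.card - (removeHooks lam k).card) : (hookTableau lam).hookIndex a < k := by
  by_contra! hge
  obtain ⟨b, hb⟩ : ∃ b : ℕ × ℕ, (b.1 + k, b.2 + k) = ((hookTableau lam).box a).1 := by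
    simp only [StandardTableau.hookIndex] at hge
    exact ⟨(((hookTableau lam).box a).1.1 - k, ((hookTableau lam).box a).1.2 - k),
      Prod.ext (by simp only; omega) (by simp only; omega)⟩
  have he := hookEntry_shift lam k b
  rw [hb, hookEntry_box] at he
  omega

end HookTableau

/-! ### Uniqueness of the value -/

section Uniqueness

variable {lam : YoungDiagram} (L : StandardTableau lam)

/-- The tuples in the subspace of the principal hooks that are constant outside the first `k`
principal hooks. -/
def innerConstantSubspace (k : ℕ) : Submodule QField (Fin lam.card → QField) where
  carrier := {z | z ∈ hookSubspace L ∧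
    ∀ a b, k ≤ L.hookIndex a → k ≤ L.hookIndex b → z a = z b}
  add_mem' := by
    rintro x y ⟨hx, hx'⟩ ⟨hy, hy'⟩
    refine ⟨Submodule.add_mem _ hx hy, fun a b ha hb => ?_⟩
    rw [Pi.add_apply, Pi.add_apply, hx' a b ha hb, hy' a b ha hb]
  zero_mem' := ⟨Submodule.zero_mem _, fun _ _ _ _ => rfl⟩
  smul_mem' := by
    rintro c x ⟨hx, hx'⟩
    refine ⟨Submodule.smul_mem _ c hx, fun a b ha hb => ?_⟩
    rw [Pi.smul_apply, Pi.smul_apply, hx' a b ha hb]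

theorem const_mem_innerConstantSubspace (k : ℕ) (t : QField) :
    (fun _ => t) ∈ innerConstantSubspace L k :=
  ⟨(mem_hookSubspace_iff L _).2 fun _ _ _ => rfl, fun _ _ _ _ => rfl⟩

/-- Distinct entries of equal content lie in different hooks, and the indicator of the hook of `i`
separates them; it vanishes outside the first `k` hooks because that hook is one of them. For
different contents a constant tuple suffices. -/
theorem exists_weight_ne {k : ℕ} {i j : Fin lam.card} (hij : i ≠ j) (hi : L.hookIndex i < k) :
    ∃ z ∈ innerConstantSubspace L k, weight L z i ≠ 0 ∧ weight L z i ≠ weight L z j := by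
  have hq : ∀ m : ℤ, q ^ m ≠ 0 := fun m => zpow_ne_zero _ q_ne_zero
  by_cases hc : L.content i = L.content j
  · have hidx : L.hookIndex j ≠ L.hookIndex i := fun h =>
      hij (eq_of_hookIndex_eq_of_content_eq L h.symm hc)
    refine ⟨fun a => if L.hookIndex a = L.hookIndex i then 1 else 0,
      ⟨(mem_hookSubspace_iff L _).2 fun a b hab => by simp only [hab], fun a b ha hb => ?_⟩, ?_, ?_⟩
    · dsimp only
      rw [if_neg (by omega), if_neg (by omega)]
    · simp [weight, hq]
    · simp [weight, hq, hidx]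
  · refine ⟨fun _ => 1, const_mem_innerConstantSubspace L k 1, ?_,
      weight_ne_of_content_ne L one_ne_zero hc⟩
    simp [weight, hq]

theorem fusionProduct_value_unique {p : Fin lam.card → QField} (hp : p ∈ hookSubspace L)
    {v w : Hecke lam.card}
    (hv : HasRegularValueAt (fusionProduct L) (domain L) (hookSubspace L) p v)
    (hw : HasRegularValueAt (fusionProduct L) (domain L) (hookSubspace L) p w) : v = w := by
  refine HasRegularValueAt.unique (ι := Fin lam.card × Fin lam.card) hp
    (fun l => if l.1 < l.2 then weightPoly L l.1 * (weightPoly L l.1 - weightPoly L l.2) else 1)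
    ?_ ?_ hv hw
  · rintro ⟨i, j⟩
    by_cases hij : i < j
    · obtain ⟨z, hz, h0, hne⟩ := exists_weight_ne L hij.ne (Nat.lt_succ_self _)
      refine ⟨z, hz.1, ?_⟩
      simp only [if_pos hij, map_mul, map_sub (MvPolynomial.eval z), eval_weightPoly]
      exact mul_ne_zero h0 (sub_ne_zero.2 hne)
    · exact ⟨0, Submodule.zero_mem _, by simp [hij]⟩
  · intro z _ h i j hij
    have := h (i, j)
    simp only [if_pos hij, map_mul, map_sub (MvPolynomial.eval z), eval_weightPoly] at this
    exact ⟨left_ne_zero_of_mul this, sub_ne_zero.1 (right_ne_zero_of_mul this)⟩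

theorem isFusionValue_unique {v w : Hecke lam.card} (hv : IsFusionValue L v)
    (hw : IsFusionValue L w) : v = w :=
  fusionProduct_value_unique L (const_mem_innerConstantSubspace L 0 1).1 (hv 1 one_ne_zero)
    (hw 1 one_ne_zero)

end Uniqueness

theorem existsUnique_isFusionValue_hookTableau (lam : YoungDiagram) :
    ∃! v, IsFusionValue (hookTableau lam) v := by
  obtain ⟨v, hv⟩ := exists_isFusionValue (hookTableau lam) (hookTableau_next lam)
  exact ⟨v, hv, fun w hw => isFusionValue_unique _ hw hv⟩

theorem isFusionValue_fusionElement (lam : YoungDiagram) :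
    IsFusionValue (hookTableau lam) (fusionElement (hookTableau lam)) := by
  have h : ∃ v, IsFusionValue (hookTableau lam) v :=
    (existsUnique_isFusionValue_hookTableau lam).exists
  rw [fusionElement, dif_pos h]
  exact h.choose_spec

/-! ### Divisibility -/

theorem incl_natFactor {m n : ℕ} (h : m ≤ n) {r : ℕ} (hr : r < m - 1) (a b : QField) :
    incl h (natFactor m r a b) = natFactor n r a b := by
  have hr' : r < n - 1 := by omega
  rw [natFactor, natFactor, map_add, AlgHom.commutes, natT, natT, dif_pos hr, dif_pos hr', incl_T]
  rfl

theorem incl_triProd {m n : ℕ} (h : m ≤ n) {w w' : ℕ → QField} {N : ℕ} (hN : N ≤ m)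
    (hw : ∀ a < N, w a = w' a) : incl h (triProd m w N) = triProd n w' N := by
  simp only [triProd, colProd, map_list_prod, List.map_map]
  refine congrArg List.prod (List.map_congr_left fun j hj => ?_)
  rw [List.mem_range] at hj
  simp only [Function.comp_apply, map_list_prod, List.map_map]
  refine congrArg List.prod (List.map_congr_left fun i hi => ?_)
  rw [List.mem_range] at hi
  rw [Function.comp_apply, incl_natFactor h (by omega), hw i (by omega), hw j hj]

section Divisibility

variable (lam : YoungDiagram) (k : ℕ)

theorem weight_comp_shiftEntry (z : Fin lam.card → QField) (a : Fin (removeHooks lam k).card) :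
    weight (hookTableau (removeHooks lam k)) (z ∘ shiftEntry lam k) a =
      weight (hookTableau lam) z (shiftEntry lam k a) := by
  rw [weight, weight, content_shiftEntry, Function.comp_apply]

/-- The generator in a factor depends only on the difference of the two entries, and a diagonal
shift preserves contents. The pairs left after the first rows therefore form the product of the
smaller tableau. -/
theorem fusionProduct_eq_rows_mul (z : Fin lam.card → QField) :
    fusionProduct (hookTableau lam) z =
      ((List.range (lam.card - (removeHooks lam k).card)).map
        (rowProd lam.card (natWeight (hookTableau lam) z) lam.card)).prod *
      incl (card_removeHooks_le lam k)
        (fusionProduct (hookTableau (removeHooks lam k)) (z ∘ shiftEntry lam k)) := by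
  have hle := card_removeHooks_le lam k
  rw [fusionProduct_eq_triProd, triProd_eq_rows_mul _ _ _
    (lam.card - (removeHooks lam k).card) (Nat.sub_le _ _), Nat.sub_sub_self hle,
    fusionProduct_eq_triProd]
  congr 1
  symm
  refine incl_triProd hle le_rfl fun a ha => ?_
  rw [natWeight, dif_pos ha, weight_comp_shiftEntry, ← natWeight_coe]
  rfl

/-- Diagonal points are excluded as soon as an entry of the removed hooks shares its content with a
later one; regularity is therefore claimed at a single point with separated weights. -/
theorem rows_regularOn {S : Set (Fin lam.card → QField)} {p : Fin lam.card → QField}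
    (hp : ∀ i j : Fin lam.card, i < j → (i : ℕ) < lam.card - (removeHooks lam k).card →
      weight (hookTableau lam) p i ≠ weight (hookTableau lam) p j) :
    RegularOn (fun z => ((List.range (lam.card - (removeHooks lam k).card)).map
        (rowProd lam.card (natWeight (hookTableau lam) z) lam.card)).prod)
      (domain (hookTableau lam)) S {p} := by
  have factor : ∀ i j, i < lam.card - (removeHooks lam k).card → j < lam.card - i - 1 →
      RegularOn (fun z => natFactor lam.card j (natWeight (hookTableau lam) z i)
        (natWeight (hookTableau lam) z (i + j + 1))) (domain (hookTableau lam)) S {p} := by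
    intro i j hi hj
    obtain ⟨a, ha⟩ : ∃ a : Fin lam.card, (a : ℕ) = i := ⟨⟨i, by omega⟩, rfl⟩
    obtain ⟨b, hb⟩ : ∃ b : Fin lam.card, (b : ℕ) = i + j + 1 := ⟨⟨i + j + 1, by omega⟩, rfl⟩
    have hab : a < b := by
      rw [Fin.lt_def]
      omega
    rw [← hb, ← ha]
    exact natFactor_regularOn_singleton _ _ _ hab (hp a b hab (ha ▸ hi))
  exact RegularOn.list_prod fun i hi => RegularOn.list_prod fun j hj =>
    factor i j (List.mem_range.1 hi) (List.mem_range.1 hj)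

/-- The value for `lam` is a left multiple of the value for the diagram without the first `k`
principal hooks. -/
theorem exists_eq_mul_of_isFusionValue {v : Hecke lam.card} {w : Hecke (removeHooks lam k).card}
    (hv : IsFusionValue (hookTableau lam) v)
    (hw : IsFusionValue (hookTableau (removeHooks lam k)) w) :
    ∃ P, v = P * incl (card_removeHooks_le lam k) w := by
  by_contra hnot
  let I : Submodule QField (Hecke lam.card) :=
    LinearMap.range (LinearMap.mulRight QField (incl (card_removeHooks_le lam k) w))
  have hvI : v ∉ I := by
    rintro ⟨P, hP⟩
    exact hnot ⟨P, hP.symm⟩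
  -- If `v` were outside the left ideal `I`, a functional would vanish on `I` but not at `v`.
  -- Applied to the numerator of the fraction that gives `v`, it yields a polynomial `Q` that is
  -- nonzero at the diagonal, hence at generic points of the inner constant subspace.
  obtain ⟨φ, hφv, hφI⟩ := Submodule.exists_le_ker_of_notMem hvI
  obtain ⟨r, a, num, den, hden, hf, hvdef⟩ := hv 1 one_ne_zero
  let Q : MvPolynomial (Fin lam.card) QField := ∑ l, num l * MvPolynomial.C (φ (a l))
  have hQ : ∀ z, MvPolynomial.eval z Q = φ (∑ l, MvPolynomial.eval z (num l) • a l) := by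
    intro z
    simp [Q, map_sum]
  have hQ1 : MvPolynomial.eval (fun _ => 1) Q ≠ 0 := by
    rw [eq_inv_smul_iff₀ hden] at hvdef
    rw [hQ, ← hvdef, map_smul, smul_eq_mul]
    exact mul_ne_zero hden hφv
  -- Besides `Q` and `den`, the coordinates are kept nonzero, so that the common inner coordinate is
  -- an admissible `t`, and the weights are kept distinct, so that the rows are regular.
  obtain ⟨p, hp, hne⟩ := exists_mem_eval_ne_zero (innerConstantSubspace (hookTableau lam) k)
    (Finset.univ : Finset (Option (Fin lam.card × Fin lam.card)))
    (fun o => o.elim (Q * den * ∏ a, MvPolynomial.X a) fun l =>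
      if l.1 < l.2 ∧ (l.1 : ℕ) < lam.card - (removeHooks lam k).card then
        weightPoly (hookTableau lam) l.1 - weightPoly (hookTableau lam) l.2 else 1) (by
      rintro (_ | ⟨i, j⟩) -
      · refine ⟨_, const_mem_innerConstantSubspace _ k 1, ?_⟩
        simp only [Option.elim, map_mul, map_prod, MvPolynomial.eval_X, Finset.prod_const_one,
          mul_one]
        exact mul_ne_zero hQ1 hden
      · by_cases hij : i < j ∧ (i : ℕ) < lam.card - (removeHooks lam k).card
        · obtain ⟨z, hz, -, hzne⟩ := exists_weight_ne (hookTableau lam) hij.1.ne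
            (hookIndex_lt_of_lt lam k i hij.2)
          refine ⟨z, hz, ?_⟩
          simp only [Option.elim, if_pos hij, map_sub (MvPolynomial.eval z), eval_weightPoly]
          exact sub_ne_zero.2 hzne
        · exact ⟨0, Submodule.zero_mem _, by simp only [Option.elim, if_neg hij]; simp⟩)
  have hp0 := hne none (Finset.mem_univ _)
  simp only [Option.elim, map_mul, map_prod, MvPolynomial.eval_X] at hp0
  have hpX := Finset.prod_ne_zero_iff.1 (right_ne_zero_of_mul hp0)
  have hpden := right_ne_zero_of_mul (left_ne_zero_of_mul hp0)
  have hpQ := left_ne_zero_of_mul (left_ne_zero_of_mul hp0)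
  have hpw : ∀ i j : Fin lam.card, i < j → (i : ℕ) < lam.card - (removeHooks lam k).card →
      weight (hookTableau lam) p i ≠ weight (hookTableau lam) p j := by
    intro i j hij hi
    have := hne (some (i, j)) (Finset.mem_univ _)
    simp only [Option.elim, if_pos (And.intro hij hi), map_sub (MvPolynomial.eval p),
      eval_weightPoly] at this
    exact sub_ne_zero.1 this
  obtain ⟨t, ht, hpt⟩ : ∃ t : QField, t ≠ 0 ∧ p ∘ shiftEntry lam k = fun _ => t := by
    rcases isEmpty_or_nonempty (Fin (removeHooks lam k).card) with h | ⟨⟨b⟩⟩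
    · exact ⟨1, one_ne_zero, funext fun a => h.elim a⟩
    · refine ⟨p (shiftEntry lam k b), hpX _ (Finset.mem_univ _), funext fun c => ?_⟩
      refine hp.2 _ _ ?_ ?_ <;> rw [hookIndex_shiftEntry] <;> omega
  have hinner : HasRegularValueAt (fun z => incl (card_removeHooks_le lam k)
      (fusionProduct (hookTableau (removeHooks lam k)) (z ∘ shiftEntry lam k)))
      (domain (hookTableau lam)) (hookSubspace (hookTableau lam)) p
      (incl (card_removeHooks_le lam k) w) := by
    refine HasRegularValueAt.comp (shiftEntry lam k) _ (hpt ▸ hw t ht) ?_ ?_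
    · intro z hz
      refine (mem_hookSubspace_iff _ _).2 fun a b hab => ?_
      refine (mem_hookSubspace_iff _ z).1 hz _ _ ?_
      rw [hookIndex_shiftEntry, hookIndex_shiftEntry, hab]
    · intro z hz a b hab
      rw [weight_comp_shiftEntry, weight_comp_shiftEntry]
      exact hz _ _ (Fin.mk_lt_mk.2 (Nat.add_lt_add_right hab _))
  obtain ⟨x, hx⟩ := rows_regularOn lam k (S := hookSubspace (hookTableau lam)) hpw
  have h1 := ((hx p rfl).mul hinner).congr fun z _ _ => fusionProduct_eq_rows_mul lam k z
  -- The fraction that gives `v` at the diagonal also gives the value at `p`. By uniqueness this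
  -- value is the product of the rows with the inner value, so it lies in `I` and `φ` kills it,
  -- contrary to the choice of `Q`.
  have h2 : HasRegularValueAt (fusionProduct (hookTableau lam)) (domain (hookTableau lam))
      (hookSubspace (hookTableau lam)) p
      ((MvPolynomial.eval p den)⁻¹ • ∑ l, MvPolynomial.eval p (num l) • a l) :=
    ⟨r, a, num, den, hpden, hf, rfl⟩
  have h3 := fusionProduct_value_unique _ hp.1 h1 h2
  rw [eq_inv_smul_iff₀ hpden] at h3
  refine hpQ ?_
  rw [hQ, ← h3, map_smul, show φ (x * _) = 0 from hφI ⟨x, rfl⟩, smul_zero]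

end Divisibility

end HookFusion

end

theorem proposition2p6 (lam : YoungDiagram) (k : ℕ) :
    (∃! v, HookFusion.IsFusionValue (HookFusion.hookTableau lam) v) ∧
    (∃! w, HookFusion.IsFusionValue
      (HookFusion.hookTableau (HookFusion.removeHooks lam k)) w) ∧
    ∃ P : HookFusion.Hecke lam.card,
      HookFusion.fusionElement (HookFusion.hookTableau lam) =
        P * HookFusion.incl (HookFusion.card_removeHooks_le lam k)
          (HookFusion.fusionElement
            (HookFusion.hookTableau (HookFusion.removeHooks lam k))) :=
  ⟨HookFusion.existsUnique_isFusionValue_hookTableau lam,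
    HookFusion.existsUnique_isFusionValue_hookTableau _,
    HookFusion.exists_eq_mul_of_isFusionValue lam k
      (HookFusion.isFusionValue_fusionElement lam) (HookFusion.isFusionValue_fusionElement _)⟩
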